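/- Multigraphs are finite and have no loops; parallel edges are allowed. For a multigraph $G$ and a vertex $x$, let $N(x)$ be the set of vertices adjacent to $x$, let $d(x)$ be the number of edges incident with $x$ (parallel edges counted separately), and let $\Delta(G)$ be the maximum degree. The chromatic index $\chi'(G)$ is the least number of colors in an edge-coloring of $G$ in which any two distinct edges sharing an end get distinct colors. The multigraph $G$ is \emph{critical} if $\chi'(G-e)<\chi'(G)$ for every edge $e$ of $G$, and it is a \emph{thickened cycle} if its underlying simple graph is a cycle (of length at least $3$). The \emph{claw-degree} of a vertex $x$ is \[ d_{claw}(x) = \max_{S\subseteq N(x),\ |S|=3} \frac14\Bigl(d(x)+\sum_{v\in S} d(v)\Bigr), \] with $d_{claw}(x)=0$ if $|N(x)|\le 2$, and the claw-degree of $G$ is $d_{claw}(G)=\max_{x\in V(G)} d_{claw}(x)$. \textbf{Theorem.} Let $G$ be a critical multigraph without isolated vertices that is not a thickened cycle. Then \[ \chi'(G)\le\max\Bigl\{\Delta(G)+1,\ \Bigl\lceil \tfrac43\, d_{claw}(G)\Bigr\rceil\Bigr\}. \] -/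

import Mathlib

open scoped Graph

noncomputable section

namespace Graph

variable {α β : Type*}

/-- The number `d(v)` of edges incident with `v`. For loopless multigraphs this is the degree
of `v`, parallel edges being counted separately. -/
def degree (G : Graph α β) (v : α) : ℕ := (G.incidenceSet v).ncard

/-- The maximum degree `Δ(G)` of a finite multigraph. -/
def maxDegree (G : Graph α β) : ℕ := ⨆ v : V(G), G.degree v

/-- The set `N(v)` of vertices joined to `v` by at least one edge. -/
def neighbors (G : Graph α β) (v : α) : Set α := {w | G.Adj v w}

/-- `c` colors the edges of `G` with the `k` colors `0, …, k - 1`, and any two distinct edges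
sharing an end receive distinct colors. (Values of `c` outside `E(G)` are irrelevant.) -/
def IsEdgeColoring (G : Graph α β) (k : ℕ) (c : β → ℕ) : Prop :=
  (∀ e ∈ E(G), c e < k) ∧ ∀ e f x, e ≠ f → G.Inc e x → G.Inc f x → c e ≠ c f

/-- The chromatic index `χ'(G)`: the least `k` such that the (finite) multigraph `G` has a proper
edge-coloring with `k` colors. -/
def chromaticIndex (G : Graph α β) : ℕ := sInf {k | ∃ c, G.IsEdgeColoring k c}

/-- `G` is critical: deleting any single edge lowers the chromatic index. -/
def IsCritical (G : Graph α β) : Prop :=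
  ∀ e ∈ E(G), (G.deleteEdges {e}).chromaticIndex < G.chromaticIndex

/-- `G` is a thickened cycle: its underlying simple graph is a cycle. -/
def IsThickenedCycle (G : Graph α β) : Prop :=
  ∃ n, 3 ≤ n ∧ Nonempty (G.toSimpleGraph ≃g SimpleGraph.cycleGraph n)

/-- The claw-degree of a vertex: the maximum, over all three-element sets `S` of neighbors of `x`,
of `(d(x) + ∑ v ∈ S, d(v)) / 4`. If `x` has at most two neighbors, the set is empty and the
value is `sSup ∅ = 0`, as it should be. -/
def clawDegreeAt (G : Graph α β) (x : α) : ℝ :=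
  sSup {r : ℝ | ∃ S : Finset α, (S : Set α) ⊆ G.neighbors x ∧ S.card = 3 ∧
    r = (1 / 4 : ℝ) * ((G.degree x : ℝ) + ∑ v ∈ S, (G.degree v : ℝ))}

/-- The claw-degree of a finite multigraph: the maximum of the claw-degrees of its vertices. -/
def clawDegree (G : Graph α β) : ℝ := ⨆ x : V(G), G.clawDegreeAt x

end Graph

end

/-! Suppose the bound fails and put `k = χ'(G) - 1`. Then all degrees are below `k`, every claw has
degree sum at most `3k`, and `G` is not `k`-colorable although every `G - e` is. Color all edges but
`e`: a vertex `v` misses `k - d(v)` colors, and one more if it is an end of `e`.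

Call a set elementary if its vertices have disjoint sets of missing colors, so that together they
miss at most `k`. A claw misses at least `4k - 3k = k` and an end of `e` tips the balance: no
elementary set containing an end of `e` contains a claw (`IsLarge.no_elementary_claw`).

A Kempe chain between the ends of `e` closes up with `e` to an odd cycle `C`, elementary by
Kierstead's theorem (`IsLarge.kierstead`). Hence `C` has no chord (`IsAltCycle.adj_iff`), and no
edge whose color is missing on `C` leaves `C`, since its outer end would complete a claw
(`IsAltCycle.mem_of_isMissing`). Kempe changes extend this: at most one edge of each color leaves
`C` (`IsAltCycle.leaving_unique`).

With `n = |C|`, each of the `k` colors therefore covers at least `n - 1` vertices of `C` by edges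
inside `C`; together with `e` there are more than `k(n - 1)/2` edges inside. As `n` is odd, `k`
colors cannot color so many, so deleting an edge not inside `C` would not make `G` `k`-colorable. By
criticality all edges lie inside `C` (`IsAltCycle.mem_of_inc`), and `G` is a thickened cycle. -/

namespace Graph

variable {α β : Type*} {G : Graph α β}

/-! ### Proper colorings and Kempe changes -/

/-- Distinct edges sharing an end get distinct colors. -/
def IsProper (G : Graph α β) (φ : β → ℕ) : Prop :=
  ∀ g h x, g ≠ h → G.Inc g x → G.Inc h x → φ g ≠ φ h

lemma IsProper.edge_eq {φ : β → ℕ} (hφ : G.IsProper φ) {g h : β} {x : α} (hg : G.Inc g x)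
    (hh : G.Inc h x) (e : φ g = φ h) : g = h := by
  by_contra hne
  exact hφ g h x hne hg hh e

/-- `K` is a union of components of the subgraph formed by the edges colored `a` or `b`. -/
def IsKempeClosed (G : Graph α β) (φ : β → ℕ) (a b : ℕ) (K : Set α) : Prop :=
  ∀ g x y, G.IsLink g x y → (φ g = a ∨ φ g = b) → x ∈ K → y ∈ K

/-- Lets a Kempe change act on everything off a chain, leaving the edges at the chain untouched. -/
lemma IsKempeClosed.compl {φ : β → ℕ} {a b : ℕ} {K : Set α} (h : G.IsKempeClosed φ a b K) :
    G.IsKempeClosed φ a b Kᶜ :=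
  fun g x y hg hc hx hy => hx (h g y x hg.symm hc hy)

open Classical in
/-- Exchange the colors `a` and `b` on the edges meeting `K`. -/
noncomputable def kempe (G : Graph α β) (φ : β → ℕ) (a b : ℕ) (K : Set α) (g : β) : ℕ :=
  if ∃ v ∈ K, G.Inc g v then Equiv.swap a b (φ g) else φ g

section kempe

variable {φ : β → ℕ} {a b : ℕ} {K : Set α} {g : β} {x : α}

lemma kempe_of_mem (hg : G.Inc g x) (hx : x ∈ K) :
    G.kempe φ a b K g = Equiv.swap a b (φ g) :=
  if_pos ⟨x, hx, hg⟩

lemma kempe_of_notMem (hK : G.IsKempeClosed φ a b K) (hg : G.Inc g x) (hx : x ∉ K) :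
    G.kempe φ a b K g = φ g := by
  unfold kempe
  split_ifs with h
  · obtain ⟨v, hv, hgv⟩ := h
    by_cases hc : φ g = a ∨ φ g = b
    · obtain ⟨y, hy⟩ := hgv
      rcases hg.eq_or_eq_of_isLink hy with rfl | rfl
      · exact absurd hv hx
      · exact absurd (hK g v x hy hc hv) hx
    · push Not at hc
      exact Equiv.swap_apply_of_ne_of_ne hc.1 hc.2
  · rfl

lemma kempe_of_ne (h : φ g ≠ a) (h' : φ g ≠ b) : G.kempe φ a b K g = φ g := by
  unfold kempe
  split_ifs
  · exact Equiv.swap_apply_of_ne_of_ne h h'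
  · rfl

lemma kempe_eq_iff {c : ℕ} (h : c ≠ a) (h' : c ≠ b) : G.kempe φ a b K g = c ↔ φ g = c := by
  unfold kempe
  split_ifs
  · rw [Equiv.swap_apply_eq_iff, Equiv.swap_apply_of_ne_of_ne h h']
  · rfl

lemma IsProper.kempe (hφ : G.IsProper φ) (hK : G.IsKempeClosed φ a b K) :
    G.IsProper (G.kempe φ a b K) := by
  intro g h x hne hg hh
  by_cases hx : x ∈ K
  · rw [kempe_of_mem hg hx, kempe_of_mem hh hx]
    exact fun e => hφ g h x hne hg hh ((Equiv.swap a b).injective e)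
  · rw [kempe_of_notMem hK hg hx, kempe_of_notMem hK hh hx]
    exact hφ g h x hne hg hh

end kempe

/-! ### Colorings with one uncolored edge, and missing colors -/

/-- The edges of `G` other than `e` are properly colored with `0, …, k - 1`;
the edge `e` carries the dummy color `k`. -/
structure IsAlmostColoring (G : Graph α β) (k : ℕ) (e : β) (φ : β → ℕ) : Prop where
  proper : G.IsProper φ
  mem : e ∈ E(G)
  le : ∀ g ∈ E(G), φ g ≤ k
  eq_iff : ∀ g ∈ E(G), φ g = k ↔ g = e

/-- The genuine color `c < k` does not occur at `v`. -/
def IsMissing (G : Graph α β) (k : ℕ) (φ : β → ℕ) (v : α) (c : ℕ) : Prop :=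
  c < k ∧ ∀ g, G.Inc g v → φ g ≠ c

section missing

variable {φ : β → ℕ} {a b c k : ℕ} {K : Set α} {e : β} {v : α}

lemma IsAlmostColoring.kempe (hφ : G.IsAlmostColoring k e φ) (ha : a < k) (hb : b < k)
    (hK : G.IsKempeClosed φ a b K) : G.IsAlmostColoring k e (G.kempe φ a b K) where
  proper := hφ.proper.kempe hK
  mem := hφ.mem
  le g hg := by
    unfold Graph.kempe
    have := hφ.le g hg
    split_ifs
    · rw [Equiv.swap_apply_def]
      split_ifs <;> omega
    · exact this
  eq_iff g hg := by rw [kempe_eq_iff ha.ne' hb.ne', hφ.eq_iff g hg]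

lemma isMissing_kempe_of_ne (hc : c ≠ a) (hc' : c ≠ b) :
    G.IsMissing k (G.kempe φ a b K) v c ↔ G.IsMissing k φ v c := by
  simp only [IsMissing, ne_eq, kempe_eq_iff hc hc']

lemma isMissing_kempe_of_notMem (hK : G.IsKempeClosed φ a b K) (hv : v ∉ K) :
    G.IsMissing k (G.kempe φ a b K) v c ↔ G.IsMissing k φ v c :=
  and_congr_right fun _ => forall₂_congr fun g hg => by rw [kempe_of_notMem hK hg hv]

lemma isMissing_kempe_left (hb : b < k) (hv : v ∈ K) (h : G.IsMissing k φ v a) :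
    G.IsMissing k (G.kempe φ a b K) v b := by
  refine ⟨hb, fun g hg => ?_⟩
  rw [kempe_of_mem hg hv, ne_eq, Equiv.swap_apply_eq_iff, Equiv.swap_apply_right]
  exact h.2 g hg

lemma isMissing_kempe_right (ha : a < k) (hv : v ∈ K) (h : G.IsMissing k φ v b) :
    G.IsMissing k (G.kempe φ a b K) v a := by
  refine ⟨ha, fun g hg => ?_⟩
  rw [kempe_of_mem hg hv, ne_eq, Equiv.swap_apply_eq_iff, Equiv.swap_apply_left]
  exact h.2 g hg

/-- If a common color is missing at both ends of the uncolored edge, it can be colored. -/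
lemma IsAlmostColoring.not_isMissing_both (hφ : G.IsAlmostColoring k e φ)
    (hno : ¬ ∃ c, G.IsEdgeColoring k c) {x y : α} (he : G.IsLink e x y)
    (hx : G.IsMissing k φ x c) (hy : G.IsMissing k φ y c) : False := by
  classical
  apply hno
  refine ⟨fun g => if g = e then c else φ g, fun g hg => ?_, fun g h z hne hg hh => ?_⟩
  · dsimp only
    split_ifs with hge
    · exact hx.1
    · exact lt_of_le_of_ne (hφ.le g hg) fun h => hge ((hφ.eq_iff g hg).1 h)
  · have key : ∀ g, G.Inc g z → G.Inc e z → φ g ≠ c := by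
      intro g hg hez
      rcases hez.eq_or_eq_of_isLink he with rfl | rfl
      · exact hx.2 g hg
      · exact hy.2 g hg
    dsimp only
    split_ifs with h1 h2 h2
    · exact absurd (h1.trans h2.symm) hne
    · subst h1; exact (key h hh hg).symm
    · subst h2; exact key g hg hh
    · exact hφ.proper g h z hne hg hh

end missing

/-! ### Kempe chains -/

/-- The colors `a, b, a, b, …`. -/
def altColor (a b i : ℕ) : ℕ := if Even i then a else b

lemma altColor_succ (a b i : ℕ) : altColor a b (i + 1) = altColor b a i := by
  unfold altColor
  by_cases h : Even i <;> simp [h, Nat.even_add_one]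

lemma altColor_eq_or (a b i : ℕ) : altColor a b i = a ∨ altColor a b i = b := by
  unfold altColor
  split_ifs <;> simp

lemma altColor_zero (a b : ℕ) : altColor a b 0 = a := by simp [altColor]

/-- A maximal path alternately colored `a` and `b`, that starts at a vertex missing `b`. -/
structure IsKempeChain (G : Graph α β) (φ : β → ℕ) (a b : ℕ) (p : ℕ → α) (L : ℕ) : Prop where
  link : ∀ i < L, ∃ g, G.IsLink g (p i) (p (i + 1)) ∧ φ g = altColor a b i
  start : ∀ g, G.Inc g (p 0) → φ g ≠ b
  last : ∀ g, G.Inc g (p L) → φ g ≠ altColor a b L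
  inj : Set.InjOn p (Set.Iic L)

section chain

variable {φ : β → ℕ} {a b : ℕ} {p : ℕ → α} {L : ℕ} {v : α}

open Classical in
/-- The other end of the edge colored `c` at `v`, or `v` itself if there is none. -/
noncomputable def partner (G : Graph α β) (φ : β → ℕ) (c : ℕ) (v : α) : α :=
  if h : ∃ w, ∃ g, G.IsLink g v w ∧ φ g = c then h.choose else v

lemma IsProper.partner_eq (hφ : G.IsProper φ) {g : β} {w : α} (hg : G.IsLink g v w) :
    G.partner φ (φ g) v = w := by
  have h : ∃ w, ∃ g', G.IsLink g' v w ∧ φ g' = φ g := ⟨w, g, hg, rfl⟩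
  rw [partner, dif_pos h]
  obtain ⟨g', hg', e⟩ := h.choose_spec
  obtain rfl := hφ.edge_eq hg'.inc_left hg.inc_left e
  exact hg'.right_unique hg

lemma partner_eq_self {c : ℕ} (h : ∀ g, G.Inc g v → φ g ≠ c) : G.partner φ c v = v := by
  rw [partner, dif_neg]
  rintro ⟨w, g, hg, e⟩
  exact h g hg.inc_left e

lemma partner_spec {c : ℕ} (h : G.partner φ c v ≠ v) :
    ∃ g, G.IsLink g v (G.partner φ c v) ∧ φ g = c := by
  by_cases h' : ∃ w, ∃ g, G.IsLink g v w ∧ φ g = c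
  · rw [partner, dif_pos h']
    exact h'.choose_spec
  · rw [partner, dif_neg h'] at h
    exact absurd rfl h

/-- The default value `v` makes `partner` an involution on all vertices, so that a chain can be
traced by alternating two involutions. -/
lemma IsProper.partner_partner (hφ : G.IsProper φ) (c : ℕ) :
    G.partner φ c (G.partner φ c v) = v := by
  by_cases h : G.partner φ c v = v
  · rw [h, h]
  · obtain ⟨g, hg, rfl⟩ := partner_spec h
    exact hφ.partner_eq hg.symm

lemma IsProper.missing_of_partner_eq_self [G.Loopless] (hφ : G.IsProper φ) {c : ℕ}
    (h : G.partner φ c v = v) : ∀ g, G.Inc g v → φ g ≠ c := by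
  rintro g ⟨w, hw⟩ rfl
  rw [hφ.partner_eq hw] at h
  exact hw.ne h.symm

/-- Alternating application of two involutions to a fixed point of the second one traces out
a path that ends at the first stop. -/
lemma exists_alternating_path {s t : α → α} {x : α} (hs : Function.Involutive s)
    (ht : Function.Involutive t) (hx : t x = x) {V : Set α} (hV : V.Finite) (hxV : x ∈ V)
    (hsV : Set.MapsTo s V V) (htV : Set.MapsTo t V V) :
    ∃ (p : ℕ → α) (L : ℕ), p 0 = x ∧
      (∀ i, p (i + 1) = (if Even i then s else t) (p i)) ∧
      p (L + 1) = p L ∧ Set.InjOn p (Set.Iic L) := by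
  classical
  let p : ℕ → α := fun n => Nat.rec x (fun i q => (if Even i then s else t) q) n
  have hp : ∀ i, p (i + 1) = (if Even i then s else t) (p i) := fun i => rfl
  have hp' : ∀ i, p i = (if Even i then s else t) (p (i + 1)) := by
    intro i
    rw [hp]
    split_ifs
    · exact (hs _).symm
    · exact (ht _).symm
  have hpV : ∀ i, p i ∈ V := by
    intro i
    induction i with
    | zero => exact hxV
    | succ i ih =>
      rw [hp]
      split_ifs
      · exact hsV ih
      · exact htV ih
  have hrep : ∃ j, ∃ i < j, p i = p j := by
    obtain ⟨i, -, j, -, hij, e⟩ :=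
      Set.infinite_univ.exists_ne_map_eq_of_mapsTo (fun i _ => hpV i) hV
    rcases lt_or_gt_of_ne hij with h | h
    · exact ⟨j, i, h, e⟩
    · exact ⟨i, j, h, e.symm⟩
  have least : ∀ P : ℕ → Prop, (∃ j, P j) → ∃ j, P j ∧ ∀ j' < j, ¬ P j' :=
    fun P h => ⟨Nat.find h, Nat.find_spec h, fun j' => Nat.find_min h⟩
  obtain ⟨j, ⟨i, hij, e⟩, hmin'⟩ := least _ hrep
  have hmin : ∀ j' < j, ∀ i' < j', p i' ≠ p j' :=
    fun j' hj' i' hi' h => hmin' j' hj' ⟨i', hi', h⟩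
  have hinj : Set.InjOn p (Set.Iic (j - 1)) := by
    intro u hu v hv huv
    simp only [Set.mem_Iic] at hu hv
    by_contra hne
    rcases lt_or_gt_of_ne hne with h | h
    · exact hmin v (by omega) u h huv
    · exact hmin u (by omega) v h huv.symm
  refine ⟨p, j - 1, rfl, hp, ?_, hinj⟩
  obtain ⟨l, rfl⟩ : ∃ l, j = l + 1 := ⟨j - 1, by omega⟩
  simp only [Nat.add_sub_cancel] at *
  by_cases hil : i = l
  · rw [← e, hil]
  exfalso
  -- Undoing the last step turns the first repetition `p i = p (l + 1)` into an earlier one unless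
  -- `i = l`; for `i = 0` this may use `t x = x`.
  have e' : p l = (if Even l then s else t) (p i) := by rw [e]; exact hp' l
  rcases Nat.eq_zero_or_pos i with rfl | hi
  · by_cases hl : Even l
    · rw [if_pos hl] at e'
      have h1 : p l = p 1 := by rw [e', show p 1 = _ from hp 0, if_pos (by simp)]
      have hl1 : l ≠ 1 := by rintro rfl; simp at hl
      exact hmin l (by omega) 1 (by omega) h1.symm
    · rw [if_neg hl] at e'
      exact hmin l (by omega) 0 (by omega) (e'.trans hx).symm
  · obtain ⟨m, rfl⟩ : ∃ m, i = m + 1 := ⟨i - 1, by omega⟩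
    by_cases hpar : Even l ↔ Even m
    · have : p l = p m := by rw [e', hp' m]; simp only [hpar]
      exact hmin l (by omega) m (by omega) this.symm
    · have h1 : p l = p (m + 1 + 1) := by
        rw [e', hp (m + 1)]
        have : Even l ↔ Even (m + 1) := by rw [Nat.even_add_one]; tauto
        simp only [this]
      rcases lt_trichotomy (m + 2) l with h | h | h
      · exact hmin l (by omega) (m + 2) h h1.symm
      · apply hpar
        subst h
        simp [Nat.even_add]
      · omega

lemma IsProper.exists_isKempeChain [G.Loopless] (hφ : G.IsProper φ) (hV : V(G).Finite)
    (hv : v ∈ V(G)) (a : ℕ) (hb : ∀ g, G.Inc g v → φ g ≠ b) :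
    ∃ p L, p 0 = v ∧ G.IsKempeChain φ a b p L := by
  have hmaps : ∀ c, Set.MapsTo (G.partner φ c) V(G) V(G) := by
    intro c w hw
    by_cases h : G.partner φ c w = w
    · rwa [h]
    · exact (partner_spec h).choose_spec.1.right_mem
  obtain ⟨p, L, h0, hp, hL, hinj⟩ := exists_alternating_path
    (s := G.partner φ a) (t := G.partner φ b) (fun w => hφ.partner_partner a)
    (fun w => hφ.partner_partner b) (partner_eq_self hb) hV hv (hmaps a) (hmaps b)
  have hp' : ∀ i, p (i + 1) = G.partner φ (altColor a b i) (p i) := by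
    intro i
    rw [hp]
    unfold altColor
    split_ifs <;> rfl
  refine ⟨p, L, h0, ⟨fun i hi => ?_, h0 ▸ hb, ?_, hinj⟩⟩
  · have : G.partner φ (altColor a b i) (p i) ≠ p i := by
      rw [← hp']
      intro h
      have := hinj (show i + 1 ≤ L from hi) (show i ≤ L from hi.le) h
      omega
    rw [hp']
    exact partner_spec this
  · rw [hp'] at hL
    exact hφ.missing_of_partner_eq_self hL

lemma IsKempeChain.closed (h : G.IsKempeChain φ a b p L) (hφ : G.IsProper φ) :
    G.IsKempeClosed φ a b (p '' Set.Iic L) := by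
  rintro g _ y hg hc ⟨i, hi, rfl⟩
  simp only [Set.mem_Iic] at hi
  by_cases hnext : φ g = altColor a b i
  · rcases hi.lt_or_eq with hlt | rfl
    · obtain ⟨g', hg', e'⟩ := h.link i hlt
      obtain rfl := hφ.edge_eq hg'.inc_left hg.inc_left (e'.trans hnext.symm)
      rw [hg.right_unique hg']
      exact ⟨i + 1, hlt, rfl⟩
    · exact absurd hnext (h.last g hg.inc_left)
  · cases i with
    | zero =>
      rw [altColor_zero] at hnext
      exact absurd (hc.resolve_left hnext) (h.start g hg.inc_left)
    | succ i =>
      obtain ⟨g', hg', e'⟩ := h.link i hi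
      have : φ g = altColor a b i := by
        rw [altColor_succ] at hnext
        unfold altColor at *
        split_ifs at * <;> tauto
      obtain rfl := hφ.edge_eq hg'.inc_right hg.inc_left (e'.trans this.symm)
      rw [hg.right_unique hg'.symm]
      exact ⟨i, (by simp only [Set.mem_Iic]; omega), rfl⟩

/-- Only the two ends of a chain can miss one of its colors. -/
lemma IsKempeChain.eq_of_missing (h : G.IsKempeChain φ a b p L) {i : ℕ} (hi : i ≤ L)
    {c : ℕ} (hc : c = a ∨ c = b) (hm : ∀ g, G.Inc g (p i) → φ g ≠ c) : i = 0 ∨ i = L := by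
  by_contra! hne
  obtain ⟨j, rfl⟩ : ∃ j, i = j + 1 := ⟨i - 1, by omega⟩
  obtain ⟨g, hg, e⟩ := h.link j (by omega)
  obtain ⟨g', hg', e'⟩ := h.link (j + 1) (by omega)
  have h1 := hm g hg.inc_right
  have h2 := hm g' hg'.inc_left
  rw [e] at h1
  rw [e', altColor_succ] at h2
  unfold altColor at *
  split_ifs at * <;> tauto

end chain

/-! ### Counting missing colors -/

variable {k : ℕ} {e : β} {φ : β → ℕ}

open Classical in
/-- The genuine colors missing at `v`. -/
noncomputable def missingColors (G : Graph α β) (k : ℕ) (φ : β → ℕ) (v : α) : Finset ℕ :=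
  (Finset.range k).filter fun c => G.IsMissing k φ v c

lemma mem_missingColors {v : α} {c : ℕ} : c ∈ G.missingColors k φ v ↔ G.IsMissing k φ v c := by
  simp only [missingColors, Finset.mem_filter, Finset.mem_range, and_iff_right_iff_imp]
  exact fun h => h.1

open Classical in
lemma IsProper.card_present (hφ : G.IsProper φ) {N : ℕ} (hN : ∀ g ∈ E(G), φ g < N) (v : α)
    (P : β → Prop) :
    ((Finset.range N).filter fun c => ∃ g, G.Inc g v ∧ P g ∧ φ g = c).card =
      {g | G.Inc g v ∧ P g}.ncard := by
  have hinj : Set.InjOn φ {g | G.Inc g v ∧ P g} :=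
    fun g hg h hh hgh => hφ.edge_eq hg.1 hh.1 hgh
  rw [← hinj.ncard_image, ← Set.ncard_coe_finset]
  congr 1
  ext c
  simp only [Finset.coe_filter, Finset.mem_range, Set.mem_ofPred_eq, Set.mem_image]
  constructor
  · rintro ⟨-, g, h1, h2, h3⟩
    exact ⟨g, ⟨h1, h2⟩, h3⟩
  · rintro ⟨g, ⟨h1, h2⟩, rfl⟩
    exact ⟨hN g h1.edge_mem, g, h1, h2, rfl⟩

open Classical in
-- The edges at `v` have distinct colors among `0, …, k`, and the dummy color `k` occurs exactly at
-- the ends of `e`, which therefore miss one genuine color more.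
lemma IsAlmostColoring.card_missingColors (hφ : G.IsAlmostColoring k e φ) (v : α) :
    (G.missingColors k φ v).card + G.degree v = k + if G.Inc e v then 1 else 0 := by
  have h1 := hφ.proper.card_present (N := k + 1) (fun g hg => Nat.lt_succ_of_le (hφ.le g hg)) v
    (fun _ => True)
  have h2 := Finset.card_filter_add_card_filter_not (s := Finset.range (k + 1))
    (fun c => ∃ g, G.Inc g v ∧ True ∧ φ g = c)
  have h3 : G.degree v = {g | G.Inc g v ∧ True}.ncard := by
    simp only [and_true]; rfl
  have h4 : ∀ c ∈ Finset.range k, (¬ ∃ g, G.Inc g v ∧ True ∧ φ g = c) ↔ G.IsMissing k φ v c := by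
    intro c hc
    simp only [Finset.mem_range] at hc
    simp [IsMissing, hc]
  have h5 : (∃ g, G.Inc g v ∧ True ∧ φ g = k) ↔ G.Inc e v := by
    constructor
    · rintro ⟨g, hg, -, h⟩
      rwa [← (hφ.eq_iff g hg.edge_mem).1 h]
    · exact fun h => ⟨e, h, trivial, (hφ.eq_iff e h.edge_mem).2 rfl⟩
  rw [h1, ← h3, Finset.card_range, Finset.range_add_one, Finset.filter_insert,
    Finset.filter_congr h4] at h2
  simp only [h5] at h2
  have h6 : ∀ [DecidablePred fun c => G.IsMissing k φ v c],
      ((Finset.range k).filter fun c => G.IsMissing k φ v c).card =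
        (G.missingColors k φ v).card := by
    intro _
    unfold missingColors
    congr
  by_cases h : G.Inc e v
  · simp only [h, not_true_eq_false, if_true, if_false] at h2 ⊢
    rw [h6] at h2
    omega
  · simp only [h, not_false_eq_true, if_true, if_false] at h2 ⊢
    rw [Finset.card_insert_of_notMem (by simp), h6] at h2
    omega

/-- A finite graph of maximum degree less than `k` that is not `k`-edge-colorable. -/
structure IsLarge (G : Graph α β) (k : ℕ) : Prop where
  finite : V(G).Finite
  not_colorable : ¬ ∃ c, G.IsEdgeColoring k c
  degree_lt : ∀ v ∈ V(G), G.degree v < k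

lemma IsLarge.card_missing_pos (hG : G.IsLarge k) (hφ : G.IsAlmostColoring k e φ) {v : α}
    (hv : v ∈ V(G)) : 0 < (G.missingColors k φ v).card := by
  have := hφ.card_missingColors v
  have := hG.degree_lt v hv
  omega

lemma IsLarge.one_lt_card_missing (hG : G.IsLarge k) (hφ : G.IsAlmostColoring k e φ) {v : α}
    (hv : G.Inc e v) : 1 < (G.missingColors k φ v).card := by
  have := hφ.card_missingColors v
  have := hG.degree_lt v hv.vertex_mem
  simp only [hv, if_true] at *
  omega

lemma IsLarge.exists_isMissing (hG : G.IsLarge k) (hφ : G.IsAlmostColoring k e φ) {v : α}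
    (hv : v ∈ V(G)) : ∃ c, G.IsMissing k φ v c := by
  obtain ⟨c, hc⟩ := Finset.card_pos.1 (hG.card_missing_pos hφ hv)
  exact ⟨c, mem_missingColors.1 hc⟩

/-! ### Kierstead paths -/

/-- A Kierstead path: it starts with the uncolored edge, and the color of every further edge is
missing at an earlier vertex. -/
structure IsKiersteadPath (G : Graph α β) (k : ℕ) (e : β) (φ : β → ℕ) (y : ℕ → α) (f : ℕ → β)
    (p : ℕ) : Prop where
  link : ∀ i < p, G.IsLink (f i) (y i) (y (i + 1))
  first : f 0 = e
  color : ∀ i < p, 1 ≤ i → ∃ m < i, G.IsMissing k φ (y m) (φ (f i))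
  inj : Set.InjOn y (Set.Iic p)

section kierstead

variable {y : ℕ → α} {f : ℕ → β} {p : ℕ} {a b c : ℕ} {K : Set α}

lemma IsKiersteadPath.mono (h : G.IsKiersteadPath k e φ y f p) {q : ℕ} (hq : q ≤ p) :
    G.IsKiersteadPath k e φ y f q where
  link i hi := h.link i (by omega)
  first := h.first
  color i hi h1 := h.color i (by omega) h1
  inj := h.inj.mono (Set.Iic_subset_Iic.2 hq)

lemma IsKiersteadPath.kempe (h : G.IsKiersteadPath k e φ y f p)
    (hne : ∀ i < p, 1 ≤ i → φ (f i) ≠ a ∧ φ (f i) ≠ b) :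
    G.IsKiersteadPath k e (G.kempe φ a b K) y f p where
  link := h.link
  first := h.first
  color i hi h1 := by
    obtain ⟨m, hm, hmiss⟩ := h.color i hi h1
    obtain ⟨ha, hb⟩ := hne i hi h1
    exact ⟨m, hm, by rwa [kempe_of_ne ha hb, isMissing_kempe_of_ne ha hb]⟩
  inj := h.inj

lemma IsKiersteadPath.kempe_of_notMem (h : G.IsKiersteadPath k e φ y f p)
    (hK : G.IsKempeClosed φ a b K) (hne : ∀ i < p, y i ∉ K) :
    G.IsKiersteadPath k e (G.kempe φ a b K) y f p where
  link := h.link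
  first := h.first
  color i hi h1 := by
    obtain ⟨m, hm, hmiss⟩ := h.color i hi h1
    refine ⟨m, hm, ?_⟩
    rwa [Graph.kempe_of_notMem hK (h.link i hi).inc_left (hne i hi),
      isMissing_kempe_of_notMem hK (hne m (by omega))]
  inj := h.inj

/-- The Kempe chain starting at a vertex missing one of its colors contains at most one further
vertex missing one of its colors. -/
lemma IsAlmostColoring.exists_kempe [G.Loopless] (hV : V(G).Finite)
    (hφ : G.IsAlmostColoring k e φ) {x : α}
    (hx : x ∈ V(G)) (ha : G.IsMissing k φ x a) :
    ∃ K : Set α, G.IsKempeClosed φ a b K ∧ x ∈ K ∧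
      ∀ z₁ ∈ K, ∀ z₂ ∈ K, z₁ ≠ x → z₂ ≠ x →
        (G.IsMissing k φ z₁ a ∨ G.IsMissing k φ z₁ b) →
        (G.IsMissing k φ z₂ a ∨ G.IsMissing k φ z₂ b) → z₁ = z₂ := by
  obtain ⟨q, L, rfl, hq⟩ := hφ.proper.exists_isKempeChain hV hx b ha.2
  refine ⟨q '' Set.Iic L, ?_, ⟨0, by simp, rfl⟩, ?_⟩
  · intro g x y hg hc
    exact hq.closed hφ.proper g x y hg hc.symm
  · have key : ∀ z ∈ q '' Set.Iic L, z ≠ q 0 →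
        (G.IsMissing k φ z a ∨ G.IsMissing k φ z b) → z = q L := by
      rintro _ ⟨i, hi, rfl⟩ hne hm
      have : i = 0 ∨ i = L := by
        rcases hm with hm | hm
        · exact hq.eq_of_missing hi (Or.inr rfl) hm.2
        · exact hq.eq_of_missing hi (Or.inl rfl) hm.2
      rcases this with rfl | rfl
      · exact absurd rfl hne
      · rfl
    exact fun z₁ h₁ z₂ h₂ n₁ n₂ m₁ m₂ => (key z₁ h₁ n₁ m₁).trans (key z₂ h₂ n₂ m₂).symm

/-- Kierstead's theorem: the sets of missing colors along a Kierstead path are disjoint. -/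
theorem IsLarge.kierstead [G.Loopless] (hG : G.IsLarge k) :
    ∀ p φ, G.IsAlmostColoring k e φ → G.IsKiersteadPath k e φ y f p → ∀ i < p, ∀ c,
      G.IsMissing k φ (y i) c → G.IsMissing k φ (y p) c → False := by
  intro p
  induction p using Nat.strong_induction_on with
  | _ p IH =>
  suffices ∀ d φ, G.IsAlmostColoring k e φ → G.IsKiersteadPath k e φ y f p → ∀ i, i + 1 + d = p →
      ∀ c, G.IsMissing k φ (y i) c → G.IsMissing k φ (y p) c → False by
    intro φ hφ hP i hi
    exact this (p - 1 - i) φ hφ hP i (by omega)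
  intro d
  induction d with
  | zero =>
    rintro φ hφ hP i rfl η hi hp
    simp only [add_zero] at hp
    have hlink := hP.link i (by omega)
    rcases Nat.eq_zero_or_pos i with rfl | hpos
    · rw [hP.first] at hlink
      exact hφ.not_isMissing_both hG.not_colorable hlink hi hp
    obtain ⟨m, hm, hmiss⟩ := hP.color i (by omega) hpos
    set ζ := φ (f i) with hζ
    -- As `η` is missing at both ends of `f i`, this edge can be recolored from `ζ` to `η`. This
    -- frees `ζ` at `y i`, which now shares it with `y m` on a shorter path.
    have hK : G.IsKempeClosed φ ζ η {y i, y (i + 1)} := by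
      intro g x z hg hc hx
      have hgη : ∀ u, (u = y i ∨ u = y (i + 1)) → G.Inc g u → φ g ≠ η := by
        rintro u (rfl | rfl) hu
        · exact hi.2 g hu
        · exact hp.2 g hu
      have hgf : g = f i := by
        have := hc.resolve_right (hgη x hx hg.inc_left)
        rcases hx with rfl | rfl
        · exact hφ.proper.edge_eq hg.inc_left hlink.inc_left this
        · exact hφ.proper.edge_eq hg.inc_left hlink.inc_right this
      rw [hgf] at hg
      exact hg.symm.left_eq_or_eq hlink
    have hφ' := hφ.kempe hmiss.1 hi.1 hK
    have hnot : ∀ l < i, y l ∉ ({y i, y (i + 1)} : Set α) := by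
      rintro l hl (h | h)
      · have := hP.inj (show l ≤ i + 1 by omega) (show i ≤ i + 1 by omega) h
        omega
      · have := hP.inj (show l ≤ i + 1 by omega) (show i + 1 ≤ i + 1 by omega) h
        omega
    exact IH i (by omega) _ hφ' ((hP.mono (by omega)).kempe_of_notMem hK hnot) m hm ζ
      ((isMissing_kempe_of_notMem hK (hnot m hm)).2 hmiss)
      (isMissing_kempe_right hmiss.1 (Or.inl rfl) hi)
  | succ d IHd =>
    rintro φ hφ hP i hip η hi hp
    have hV : ∀ j ≤ p, y j ∈ V(G) := by
      intro j hj
      rcases hj.lt_or_eq with h | rfl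
      · exact (hP.link j h).left_mem
      · have := (hP.link (j - 1) (by omega)).right_mem
        rwa [Nat.sub_add_cancel (by omega)] at this
    obtain ⟨ζ, hζ⟩ := hG.exists_isMissing hφ (hV (i + 1) (by omega))
    have hcol : ∀ l < i + 1, 1 ≤ l → φ (f l) ≠ η ∧ φ (f l) ≠ ζ := by
      intro l hl hl1
      obtain ⟨m, hm, hmiss⟩ := hP.color l (by omega) hl1
      refine ⟨fun h => ?_, fun h => ?_⟩
      · exact IH i (by omega) φ hφ (hP.mono (by omega)) m (by omega) _ hmiss (h ▸ hi)
      · exact IH (i + 1) (by omega) φ hφ (hP.mono (by omega)) m (by omega) _ hmiss (h ▸ hζ)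
    have hne : ∀ u ≤ p, ∀ v ≤ p, u ≠ v → y u ≠ y v :=
      fun u hu v hv h h' => h (hP.inj hu hv h')
    obtain ⟨K, hK, hiK, hends⟩ := hφ.exists_kempe (b := ζ) hG.finite (hV i (by omega)) hi
    -- If the chain from `y i` reaches `y (i + 1)`, it avoids `y p`, and a swap off the chain makes
    -- `ζ` missing at both `y (i + 1)` and `y p`, a closer pair. Otherwise a swap on the chain makes
    -- `ζ` missing at both `y i` and `y (i + 1)`, on a shorter path.
    by_cases hi1 : y (i + 1) ∈ K
    · have hpK : y p ∉ K := fun h => hne (i + 1) (by omega) p le_rfl (by omega)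
        (hends _ hi1 _ h (hne _ (by omega) _ (by omega) (by omega))
          (hne _ (by omega) _ (by omega) (by omega)) (Or.inr hζ) (Or.inl hp))
      have hi' : G.IsMissing k (G.kempe φ η ζ Kᶜ) (y i) η :=
        (isMissing_kempe_of_notMem hK.compl (by simpa using hiK)).2 hi
      have hζ' : G.IsMissing k (G.kempe φ η ζ Kᶜ) (y (i + 1)) ζ :=
        (isMissing_kempe_of_notMem hK.compl (by simpa using hi1)).2 hζ
      refine IHd _ (hφ.kempe hi.1 hζ.1 hK.compl) ⟨hP.link, hP.first, ?_, hP.inj⟩ (i + 1)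
        (by omega) ζ hζ' (isMissing_kempe_left hζ.1 hpK hp)
      intro l hl hl1
      obtain ⟨m, hm, hmiss⟩ := hP.color l hl hl1
      by_cases hc : φ (f l) ≠ η ∧ φ (f l) ≠ ζ
      · exact ⟨m, hm, by rwa [kempe_of_ne hc.1 hc.2, isMissing_kempe_of_ne hc.1 hc.2]⟩
      · have hil : i < l := by
          by_contra hil
          exact hc (hcol l (by omega) hl1)
        have hc' : G.kempe φ η ζ Kᶜ (f l) = η ∨ G.kempe φ η ζ Kᶜ (f l) = ζ := by
          have hc : φ (f l) = η ∨ φ (f l) = ζ := by tauto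
          unfold Graph.kempe
          rcases hc with h | h <;> split_ifs <;> simp [h]
        rcases hc' with h | h
        · exact ⟨i, hil, by rwa [h]⟩
        -- The case `l = i + 1` cannot arise: `f (i + 1)` is incident with `y (i + 1)`, which misses
        -- `ζ`.
        · refine ⟨i + 1, lt_of_le_of_ne hil ?_, by rwa [h]⟩
          rintro rfl
          exact hζ'.2 _ (hP.link _ hl).inc_left h
    · exact IH (i + 1) (by omega) _ (hφ.kempe hi.1 hζ.1 hK)
        ((hP.mono (by omega)).kempe hcol) i (by omega) ζ (isMissing_kempe_left hζ.1 hiK hi)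
        ((isMissing_kempe_of_notMem hK hi1).2 hζ)

/-- The version of Kierstead's theorem for two paths that differ in their last edge only. -/
theorem IsLarge.kierstead_broom [G.Loopless] (hG : G.IsLarge k) {y' : ℕ → α} {f' : ℕ → β}
    (hφ : G.IsAlmostColoring k e φ) (hP : G.IsKiersteadPath k e φ y f (p + 1))
    (hP' : G.IsKiersteadPath k e φ y' f' (p + 1)) (hy : ∀ i ≤ p, y' i = y i)
    (hne : y' (p + 1) ≠ y (p + 1))
    (h : G.IsMissing k φ (y (p + 1)) c) (h' : G.IsMissing k φ (y' (p + 1)) c) : False := by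
  have hV : y p ∈ V(G) := (hP.link p (by omega)).left_mem
  obtain ⟨ζ, hζ⟩ := hG.exists_isMissing hφ hV
  obtain ⟨K, hK, hpK, hends⟩ := hφ.exists_kempe (b := c) hG.finite hV hζ
  -- At most one of the two last vertices lies on the chain from `y p`. A swap off the chain makes
  -- `ζ` missing at the other one as well as at `y p`, against Kierstead's theorem.
  have main : ∀ (y : ℕ → α) (f : ℕ → β), G.IsKiersteadPath k e φ y f (p + 1) →
      G.IsMissing k φ (y (p + 1)) c → G.IsMissing k φ (y p) ζ → y p ∈ K →
      y (p + 1) ∉ K → False := by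
    intro y f hP h hζ hpK hK'
    refine hG.kierstead (p + 1) _ (hφ.kempe hζ.1 h.1 hK.compl) (hP.kempe ?_) p (by omega) ζ
      ((isMissing_kempe_of_notMem hK.compl (by simpa using hpK)).2 hζ)
      (isMissing_kempe_right hζ.1 hK' h)
    intro i hi hi1
    obtain ⟨m, hm, hmiss⟩ := hP.color i hi hi1
    refine ⟨fun e => ?_, fun e => ?_⟩
    · exact hG.kierstead p _ hφ (hP.mono (by omega)) m (by omega) _ hmiss (e ▸ hζ)
    · exact hG.kierstead (p + 1) _ hφ hP m (by omega) _ hmiss (e ▸ h)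
  by_cases h1 : y (p + 1) ∈ K
  · refine main y' f' hP' h' (by rwa [hy p le_rfl]) (by rwa [hy p le_rfl]) fun h2 => ?_
    refine hne (hends _ h2 _ h1 ?_ ?_ (Or.inr h') (Or.inr h))
    · intro e
      rw [← hy p le_rfl] at e
      have := hP'.inj (show p + 1 ≤ p + 1 by omega) (show p ≤ p + 1 by omega) e
      omega
    · intro e
      have := hP.inj (show p + 1 ≤ p + 1 by omega) (show p ≤ p + 1 by omega) e
      omega
  · exact main y f hP h hζ hpK h1

end kierstead

/-! ### Claws and elementary sets -/

/-- The degree sum of every claw is at most `3 * k`. -/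
def IsClawSparse (G : Graph α β) (k : ℕ) : Prop :=
  ∀ (x : α) (S : Finset α), (S : Set α) ⊆ G.neighbors x → S.card = 3 →
    G.degree x + ∑ v ∈ S, G.degree v ≤ 3 * k

/-- The vertices of `W` have pairwise disjoint sets of missing colors. -/
def IsElementary (G : Graph α β) (k : ℕ) (φ : β → ℕ) (W : Set α) : Prop :=
  W.Pairwise fun u v => ∀ c, G.IsMissing k φ u c → ¬ G.IsMissing k φ v c

lemma IsElementary.insert {W : Set α} {w : α} (hW : G.IsElementary k φ W)
    (h : ∀ v ∈ W, ∀ c, G.IsMissing k φ v c → ¬ G.IsMissing k φ w c) :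
    G.IsElementary k φ (insert w W) := by
  refine Set.Pairwise.insert hW fun v hv _ => ⟨fun c h1 h2 => h v hv c h2 h1, h v hv⟩

lemma IsElementary.sum_card_le {W : Finset α} (hW : G.IsElementary k φ (W : Set α)) :
    ∑ v ∈ W, (G.missingColors k φ v).card ≤ k := by
  classical
  rw [← Finset.card_biUnion]
  · refine (Finset.card_le_card (t := Finset.range k) ?_).trans (by simp)
    intro c hc
    obtain ⟨v, -, hv⟩ := Finset.mem_biUnion.1 hc
    exact Finset.mem_range.2 (mem_missingColors.1 hv).1
  · intro u hu v hv huv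
    refine Finset.disjoint_left.2 fun c h1 h2 => ?_
    exact hW hu hv huv c (mem_missingColors.1 h1) (mem_missingColors.1 h2)

/-- In a claw-sparse graph no elementary set containing an end of the uncolored edge contains
a claw. -/
lemma IsLarge.no_elementary_claw (hG : G.IsLarge k) (hclaw : G.IsClawSparse k)
    (hφ : G.IsAlmostColoring k e φ) {W : Set α} (hW : G.IsElementary k φ W) {x u₁ u₂ u₃ z : α}
    (hx : x ∈ W) (h₁ : u₁ ∈ W) (h₂ : u₂ ∈ W) (h₃ : u₃ ∈ W) (hz : z ∈ W) (hez : G.Inc e z)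
    (a₁ : G.Adj x u₁) (a₂ : G.Adj x u₂) (a₃ : G.Adj x u₃) (n₁ : x ≠ u₁) (n₂ : x ≠ u₂)
    (n₃ : x ≠ u₃) (n₁₂ : u₁ ≠ u₂) (n₁₃ : u₁ ≠ u₃) (n₂₃ : u₂ ≠ u₃) : False := by
  classical
  have hle := hclaw x {u₁, u₂, u₃}
    (by intro v hv; simp at hv; rcases hv with rfl | rfl | rfl <;> assumption)
    (Finset.card_eq_three.2 ⟨u₁, u₂, u₃, n₁₂, n₁₃, n₂₃, rfl⟩)
  rw [Finset.sum_insert (by simp [n₁₂, n₁₃]), Finset.sum_pair n₂₃] at hle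
  have hsub : ∀ v ∈ ({x, u₁, u₂, u₃} : Finset α), v ∈ W := by
    intro v hv
    simp only [Finset.mem_insert, Finset.mem_singleton] at hv
    rcases hv with rfl | rfl | rfl | rfl <;> assumption
  have c0 := hφ.card_missingColors x
  have c1 := hφ.card_missingColors u₁
  have c2 := hφ.card_missingColors u₂
  have c3 := hφ.card_missingColors u₃
  have hsum : ∀ g : α → ℕ, ∑ v ∈ ({x, u₁, u₂, u₃} : Finset α), g v =
      g x + (g u₁ + (g u₂ + g u₃)) := by
    intro g
    rw [Finset.sum_insert (by simp [n₁, n₂, n₃]), Finset.sum_insert (by simp [n₁₂, n₁₃]),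
      Finset.sum_pair n₂₃]
  -- The degrees alone force `4k - 3k = k` missing colors on the claw; the excess comes from an end
  -- of `e` in the claw, or from a color missing at `z` outside it.
  by_cases hzT : z ∈ ({x, u₁, u₂, u₃} : Finset α)
  · have h := IsElementary.sum_card_le (G := G) (k := k) (φ := φ) (W := {x, u₁, u₂, u₃})
      (hW.mono hsub)
    rw [hsum] at h
    simp only [Finset.mem_insert, Finset.mem_singleton] at hzT
    rcases hzT with rfl | rfl | rfl | rfl <;> simp only [hez, if_true] at c0 c1 c2 c3 <;> omega
  · have h := IsElementary.sum_card_le (G := G) (k := k) (φ := φ) (W := insert z {x, u₁, u₂, u₃})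
      (hW.mono (by
        intro v hv
        rw [Finset.coe_insert] at hv
        rcases hv with rfl | hv
        · exact hz
        · exact hsub v hv))
    rw [Finset.sum_insert hzT, hsum] at h
    have := hG.card_missing_pos hφ hez.vertex_mem
    omega

/-! ### Alternating odd cycles -/

/-- A cycle `y 0, …, y (n - 1)` of odd length through the uncolored edge `e = f 0`, whose other
edges are colored alternately `a` and `b`; indices are periodic modulo `n`. -/
structure IsAltCycle (G : Graph α β) (k : ℕ) (e : β) (φ : β → ℕ) (n : ℕ) (y : ℕ → α) (f : ℕ → β)
    (a b : ℕ) : Prop where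
  almost : G.IsAlmostColoring k e φ
  odd : Odd n
  two_lt : 2 < n
  periodic_y : Function.Periodic y n
  periodic_f : Function.Periodic f n
  link : ∀ i, G.IsLink (f i) (y i) (y (i + 1))
  inj : Set.InjOn y (Set.Iio n)
  first : f 0 = e
  color : ∀ i, 1 ≤ i → i < n → φ (f i) = altColor b a i
  left : G.IsMissing k φ (y 0) a
  right : G.IsMissing k φ (y 1) b

/-- The chain from one end of `e` must stop at the other, or a swap would free a common color for
`e`; with an odd number of edges it would leave `b` missing at both ends. -/
lemma IsLarge.exists_isAltCycle [G.Loopless] (hG : G.IsLarge k)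
    (hφ : G.IsAlmostColoring k e φ) : ∃ n y f a b, G.IsAltCycle k e φ n y f a b := by
  obtain ⟨v₀, v₁, he⟩ := exists_isLink_of_mem_edgeSet hφ.mem
  obtain ⟨a, ha⟩ := hG.exists_isMissing hφ he.left_mem
  obtain ⟨b, hb⟩ := hG.exists_isMissing hφ he.right_mem
  obtain ⟨p, L, rfl, hp⟩ := hφ.proper.exists_isKempeChain hG.finite he.right_mem a hb.2
  have hv₀ : v₀ = p L := by
    by_contra hne
    have hK := hp.closed hφ.proper
    have hv₀ : v₀ ∉ p '' Set.Iic L := by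
      rintro ⟨i, hi, rfl⟩
      rcases hp.eq_of_missing hi (Or.inl rfl) ha.2 with rfl | rfl
      · exact he.ne rfl
      · exact hne rfl
    exact (hφ.kempe ha.1 hb.1 hK).not_isMissing_both hG.not_colorable he
      ((isMissing_kempe_of_notMem hK hv₀).2 ha)
      (isMissing_kempe_right ha.1 ⟨0, by simp, rfl⟩ hb)
  subst hv₀
  have hL : Even L := by
    by_contra hL
    have := hp.last
    simp only [altColor, hL, if_false] at this
    exact hφ.not_isMissing_both hG.not_colorable he ⟨hb.1, this⟩ hb
  have hL0 : L ≠ 0 := by rintro rfl; exact he.ne rfl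
  have : Nonempty β := ⟨e⟩
  choose! g hg hgc using hp.link
  have hmod : ∀ i, ∃ q r, r < L + 1 ∧ i = r + (L + 1) * q :=
    fun i => ⟨i / (L + 1), i % (L + 1), Nat.mod_lt _ (by omega), (Nat.mod_add_div i (L + 1)).symm⟩
  have hy0 : ∀ q, (0 + (L + 1) * q + L) % (L + 1) = L := by
    intro q
    rw [show 0 + (L + 1) * q + L = L + (L + 1) * q by ring, Nat.add_mul_mod_self_left,
      Nat.mod_eq_of_lt (by omega)]
  have hys : ∀ q r, r < L + 1 → (r + 1 + (L + 1) * q + L) % (L + 1) = r := by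
    intro q r hr
    rw [show r + 1 + (L + 1) * q + L = r + (L + 1) * (q + 1) by ring, Nat.add_mul_mod_self_left,
      Nat.mod_eq_of_lt hr]
  -- The shift gives `y 0 = p L` and `y (i + 1) = p i` for `i ≤ L`, so that the uncolored edge comes
  -- first.
  refine ⟨L + 1, fun i => p ((i + L) % (L + 1)),
    fun i => if i % (L + 1) = 0 then e else g (i % (L + 1) - 1), a, b, ?_⟩
  refine ⟨hφ, hL.add_one, ?_, fun i => ?_, fun i => ?_, fun i => ?_, ?_, by simp, ?_, ?_, ?_⟩
  · rcases hL with ⟨l, rfl⟩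
    omega
  · rw [show i + (L + 1) + L = i + L + (L + 1) by ring, Nat.add_mod_right]
  · simp only [Nat.add_mod_right]
  · obtain ⟨q, r, hr, rfl⟩ := hmod i
    simp only [Nat.add_mul_mod_self_left, Nat.mod_eq_of_lt hr]
    have h1 : (r + (L + 1) * q + 1 + L) % (L + 1) = r := by
      rw [show r + (L + 1) * q + 1 = r + 1 + (L + 1) * q by ring, hys q r hr]
    rw [h1]
    cases r with
    | zero => rw [if_pos rfl, hy0]; exact he
    | succ r =>
      rw [if_neg (by omega), hys q r (by omega)]
      exact hg r (by omega)
  · intro i hi j hj hij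
    simp only [Set.mem_Iio] at hi hj
    have := hp.inj (show (i + L) % (L + 1) ≤ L from Nat.lt_succ_iff.1 (Nat.mod_lt _ (by omega)))
      (show (j + L) % (L + 1) ≤ L from Nat.lt_succ_iff.1 (Nat.mod_lt _ (by omega))) hij
    have := Nat.ModEq.add_right_cancel' L this
    rwa [Nat.ModEq, Nat.mod_eq_of_lt hi, Nat.mod_eq_of_lt hj] at this
  · intro i h1 hi
    simp only [Nat.mod_eq_of_lt hi]
    rw [if_neg (by omega), hgc _ (by omega)]
    obtain ⟨i, rfl⟩ : ∃ j, i = j + 1 := ⟨i - 1, by omega⟩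
    rw [altColor_succ, Nat.add_sub_cancel]
  · have := hy0 0
    simp only [mul_zero, add_zero] at this
    simp only [this]
    exact ha
  · have := hys 0 0 (by omega)
    simp only [mul_zero, add_zero] at this
    simp only [this]
    exact hb

namespace IsAltCycle

variable {n : ℕ} {y : ℕ → α} {f : ℕ → β} {a b c : ℕ}

lemma ne [G.Loopless] (h : G.IsAltCycle k e φ n y f a b) (hG : G.IsLarge k) : a ≠ b := by
  rintro rfl
  have := h.link 0
  rw [h.first] at this
  exact h.almost.not_isMissing_both hG.not_colorable this h.left h.right

lemma y_mod (h : G.IsAltCycle k e φ n y f a b) (i : ℕ) : y (i % n) = y i :=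
  h.periodic_y.map_mod_nat i

lemma mod_lt (h : G.IsAltCycle k e φ n y f a b) (i : ℕ) : i % n < n :=
  Nat.mod_lt _ (by have := h.two_lt; omega)

lemma y_eq_iff (h : G.IsAltCycle k e φ n y f a b) {i j : ℕ} : y i = y j ↔ i % n = j % n := by
  constructor
  · intro hij
    rw [← h.y_mod i, ← h.y_mod j] at hij
    exact h.inj (h.mod_lt i) (h.mod_lt j) hij
  · intro hij
    rw [← h.y_mod i, ← h.y_mod j, hij]

lemma exists_lt (h : G.IsAltCycle k e φ n y f a b) {v : α} (hv : v ∈ Set.range y) :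
    ∃ i < n, y i = v := by
  obtain ⟨i, rfl⟩ := hv
  exact ⟨i % n, h.mod_lt i, h.y_mod i⟩

/-- The colors of the cycle are missing at `y 0` and `y 1`, early enough for every later edge. -/
lemma isKiersteadPath (h : G.IsAltCycle k e φ n y f a b) {p : ℕ} (hp : p < n) :
    G.IsKiersteadPath k e φ y f p where
  link i _ := h.link i
  first := h.first
  color i hi h1 := by
    rw [h.color i h1 (by omega)]
    unfold altColor
    split_ifs with hpar
    · refine ⟨1, lt_of_le_of_ne h1 ?_, h.right⟩
      rintro rfl
      simp at hpar
    · exact ⟨0, h1, h.left⟩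
  inj := h.inj.mono fun i hi => lt_of_le_of_lt hi hp

lemma isElementary [G.Loopless] (h : G.IsAltCycle k e φ n y f a b) (hG : G.IsLarge k) :
    G.IsElementary k φ (Set.range y) := by
  have key : ∀ i < n, ∀ j < n, i < j → ∀ c, G.IsMissing k φ (y i) c →
      ¬ G.IsMissing k φ (y j) c := fun i _ j hj hij c h1 h2 =>
    hG.kierstead j φ h.almost (h.isKiersteadPath hj) i hij c h1 h2
  intro u hu v hv huv c h1 h2
  obtain ⟨i, hi, rfl⟩ := h.exists_lt hu
  obtain ⟨j, hj, rfl⟩ := h.exists_lt hv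
  rcases lt_trichotomy i j with hij | rfl | hij
  · exact key i hi j hj hij c h1 h2
  · exact huv rfl
  · exact key j hj i hi hij c h2 h1

lemma inc_zero (h : G.IsAltCycle k e φ n y f a b) : G.Inc e (y 0) := by
  have := (h.link 0).inc_left
  rwa [h.first] at this

/-- Kempe changes with two colors not used on the cycle preserve it. -/
lemma kempe (h : G.IsAltCycle k e φ n y f a b) {c d : ℕ} {K : Set α} (hc : c < k) (hd : d < k)
    (hca : c ≠ a) (hcb : c ≠ b) (hda : d ≠ a) (hdb : d ≠ b) (hK : G.IsKempeClosed φ c d K) :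
    G.IsAltCycle k e (G.kempe φ c d K) n y f a b where
  almost := h.almost.kempe hc hd hK
  odd := h.odd
  two_lt := h.two_lt
  periodic_y := h.periodic_y
  periodic_f := h.periodic_f
  link := h.link
  inj := h.inj
  first := h.first
  color i h1 hi := by
    have hi' := h.color i h1 hi
    rw [← hi']
    rcases altColor_eq_or b a i with h' | h' <;> rw [h'] at hi' <;>
      exact kempe_of_ne (by rw [hi']; exact Ne.symm ‹_›) (by rw [hi']; exact Ne.symm ‹_›)
  left := (isMissing_kempe_of_ne hca.symm hda.symm).2 h.left
  right := (isMissing_kempe_of_ne hcb.symm hdb.symm).2 h.right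

/-- Moving the uncolored edge one step along the cycle. -/
lemma rotate_one [G.Loopless] (h : G.IsAltCycle k e φ n y f a b) (hG : G.IsLarge k) :
    ∃ e' φ', G.IsAltCycle k e' φ' n (fun i => y (i + 1)) (fun i => f (i + 1)) b a ∧
      ∀ c, c ≠ a → c ≠ k → ∀ g, φ' g = c ↔ φ g = c := by
  have hn := h.two_lt
  have hab := h.ne hG
  have hak := h.left.1
  have hbk := h.right.1
  have hφ := h.almost
  have hf1 : φ (f 1) = a := by
    rw [h.color 1 le_rfl (by omega)]; simp [altColor]
  have hf0 : φ (f 0) = k := (hφ.eq_iff _ (h.link 0).edge_mem).2 h.first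
  have hne : ∀ i < n, ∀ j < n, i ≠ j → y i ≠ y j :=
    fun i hi j hj hij h' => hij (h.inj hi hj h')
  set K : Set α := {y 0, y 1, y 2} with hKdef
  have hedge : ∀ g x, G.Inc g x → x ∈ K → φ g = a → g = f 1 := by
    rintro g x hg (rfl | rfl | rfl) hc
    · exact absurd hc (h.left.2 g hg)
    · exact hφ.proper.edge_eq hg (h.link 1).inc_left (hc.trans hf1.symm)
    · exact hφ.proper.edge_eq hg (h.link 1).inc_right (hc.trans hf1.symm)
  -- The dummy color takes part in the swap: the edges of colors `a` and `k` meeting `K` are just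
  -- `e` and `f 1`, and they exchange colors.
  have hK : G.IsKempeClosed φ a k K := by
    intro g x z hg hc hx
    rcases hc with hc | hc
    · obtain rfl := hedge g x hg.inc_left hx hc
      rcases hg.right_eq_or_eq (h.link 1) with rfl | rfl <;> simp [hKdef]
    · obtain rfl : g = f 0 := ((hφ.eq_iff g hg.edge_mem).1 hc).trans h.first.symm
      rcases hg.right_eq_or_eq (h.link 0) with rfl | rfl <;> simp [hKdef]
  have hcolor : ∀ c, c ≠ a → c ≠ k → ∀ g, G.kempe φ a k K g = c ↔ φ g = c :=
    fun c h1 h2 g => kempe_eq_iff h1 h2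
  refine ⟨f 1, G.kempe φ a k K, ⟨⟨hφ.proper.kempe hK, (h.link 1).edge_mem, ?_, ?_⟩, h.odd, hn,
    fun i => ?_, fun i => ?_, fun i => h.link (i + 1), ?_, rfl, ?_, ?_, ?_⟩, hcolor⟩
  · intro g hg
    have := hφ.le g hg
    unfold Graph.kempe
    split_ifs
    · rw [Equiv.swap_apply_def]
      split_ifs <;> omega
    · exact this
  · intro g hg
    constructor
    · intro hgk
      by_cases hgK : ∃ v ∈ K, G.Inc g v
      · obtain ⟨v, hv, hgv⟩ := hgK
        rw [kempe_of_mem hgv hv, Equiv.swap_apply_eq_iff, Equiv.swap_apply_right] at hgk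
        exact hedge g v hgv hv hgk
      · unfold Graph.kempe at hgk
        rw [if_neg hgK, hφ.eq_iff g hg] at hgk
        subst hgk
        exact absurd ⟨y 0, by simp [hKdef], h.inc_zero⟩ hgK
    · rintro rfl
      rw [kempe_of_mem (h.link 1).inc_left (by simp [hKdef]), hf1, Equiv.swap_apply_left]
  · rw [show i + n + 1 = i + 1 + n by ring, h.periodic_y]
  · rw [show i + n + 1 = i + 1 + n by ring, h.periodic_f]
  · intro i hi j hj hij
    have := h.y_eq_iff.1 hij
    have := Nat.ModEq.add_right_cancel' 1 this
    rwa [Nat.ModEq, Nat.mod_eq_of_lt hi, Nat.mod_eq_of_lt hj] at this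
  · intro i h1 hi
    rcases lt_or_eq_of_le (Nat.succ_le_of_lt hi) with hi' | rfl
    · rw [← altColor_succ, ← h.color (i + 1) (by omega) hi']
      rcases lt_or_eq_of_le (Nat.succ_le_of_lt hi') with hi'' | hi''
      · refine kempe_of_notMem hK (h.link (i + 1)).inc_right ?_
        rintro (h' | h' | h')
        · exact hne _ hi'' 0 (by omega) (by omega) h'
        · exact hne _ hi'' 1 (by omega) (by omega) h'
        · exact hne _ hi'' 2 (by omega) (by omega) h'
      -- The edge `f (n - 1)` returns to `y 0 ∈ K`, but the swap ignores its color `b`.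
      · have hb : φ (f (i + 1)) = b := by
          rw [h.color (i + 1) (by omega) hi']
          have hodd := h.odd
          rw [← hi'', Nat.odd_add_one, Nat.not_odd_iff_even] at hodd
          simp only [altColor, if_pos hodd]
        exact kempe_of_ne (by rw [hb]; exact hab.symm) (by rw [hb]; exact hbk.ne)
    · have hodd := h.odd
      simp only [Nat.succ_eq_add_one] at *
      rw [Nat.odd_add_one, Nat.not_odd_iff_even] at hodd
      have := h.periodic_f 0
      rw [zero_add] at this
      rw [this, kempe_of_mem (h.link 0).inc_left (by simp [hKdef]), hf0, Equiv.swap_apply_right]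
      simp only [altColor, if_pos hodd]
  · exact ⟨hbk, fun g hg => by rw [ne_eq, hcolor b hab.symm hbk.ne]; exact h.right.2 g hg⟩
  · refine ⟨hak, fun g hg => ?_⟩
    simp only [Nat.reduceAdd] at hg
    rw [kempe_of_mem hg (by simp [hKdef]), ne_eq, Equiv.swap_apply_eq_iff, Equiv.swap_apply_left]
    intro hgk
    obtain rfl : g = f 0 := ((hφ.eq_iff g hg.edge_mem).1 hgk).trans h.first.symm
    rcases hg.eq_or_eq_of_isLink (h.link 0) with h' | h'
    · exact hne 2 (by omega) 0 (by omega) (by omega) h'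
    · exact hne 2 (by omega) 1 (by omega) (by omega) h'

/-- Any vertex of the cycle can take the place of `y 0`, at no cost to the colors not used on the
cycle. -/
lemma rotate [G.Loopless] (h : G.IsAltCycle k e φ n y f a b) (hG : G.IsLarge k) (m : ℕ) :
    ∃ e' φ' a' b', G.IsAltCycle k e' φ' n (fun i => y (i + m)) (fun i => f (i + m)) a' b' ∧
      (a' = a ∧ b' = b ∨ a' = b ∧ b' = a) ∧
      ∀ c, c ≠ a → c ≠ b → c ≠ k → ∀ g, φ' g = c ↔ φ g = c := by
  induction m with
  | zero => exact ⟨e, φ, a, b, h, Or.inl ⟨rfl, rfl⟩, fun _ _ _ _ _ => Iff.rfl⟩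
  | succ m ih =>
    obtain ⟨e', φ', a', b', h', hab, hc⟩ := ih
    obtain ⟨e'', φ'', h'', hc'⟩ := h'.rotate_one hG
    refine ⟨e'', φ'', b', a', ?_, by tauto, fun c h1 h2 h3 g => ?_⟩
    · convert h'' using 3 <;> ring_nf
    · rw [hc' c (by rcases hab with ⟨rfl, rfl⟩ | ⟨rfl, rfl⟩ <;> assumption) h3, hc c h1 h2 h3]

end IsAltCycle

/-! ### Edges leaving the cycle -/

namespace IsAltCycle

variable {n : ℕ} {y : ℕ → α} {f : ℕ → β} {a b c : ℕ}

/-- Two vertices of the cycle are adjacent in `G` only if they are adjacent on the cycle. -/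
lemma adj_iff [G.Loopless] (h : G.IsAltCycle k e φ n y f a b) (hG : G.IsLarge k)
    (hclaw : G.IsClawSparse k) {i j : ℕ} :
    G.Adj (y i) (y j) ↔ j % n = (i + 1) % n ∨ i % n = (j + 1) % n := by
  have hn := h.two_lt
  constructor
  · intro hadj
    by_contra! hne
    have hprev : G.Adj (y i) (y (i + (n - 1))) := by
      have := (h.link (i + (n - 1))).adj.symm
      rwa [show i + (n - 1) + 1 = i + n by omega, h.periodic_y] at this
    have hnext : G.Adj (y i) (y (i + 1)) := (h.link i).adj
    have hmem : ∀ i, y i ∈ Set.range y := fun i => ⟨i, rfl⟩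
    -- A chord gives `y i` a third neighbor on the elementary cycle, hence a claw there.
    refine hG.no_elementary_claw hclaw h.almost (h.isElementary hG) (hmem i) (hmem _) (hmem _)
      (hmem j) (hmem 0) h.inc_zero hprev hnext hadj hprev.ne hnext.ne hadj.ne ?_ ?_ ?_
    · rw [ne_eq, h.y_eq_iff]
      intro h'
      have := Nat.ModEq.add_left_cancel' i h'
      rw [Nat.ModEq, Nat.mod_eq_of_lt (by omega), Nat.mod_eq_of_lt (by omega)] at this
      omega
    · intro h'
      apply hne.2
      rw [← h.y_eq_iff, ← h.periodic_y i, show i + n = i + (n - 1) + 1 by omega, h.y_eq_iff]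
      exact Nat.ModEq.add_right 1 (h.y_eq_iff.1 h')
    · rw [ne_eq, h.y_eq_iff]
      exact fun h' => hne.1 h'.symm
  · rintro (h' | h')
    · rw [h.y_eq_iff.2 h']
      exact (h.link i).adj
    · rw [h.y_eq_iff.2 h']
      exact (h.link j).adj.symm

/-- The edges of the two colors of the cycle do not leave the cycle. -/
lemma mem_of_color_left_or_right (h : G.IsAltCycle k e φ n y f a b) (hc : c = a ∨ c = b)
    {g : β} {v w : α} (hv : v ∈ Set.range y) (hg : G.IsLink g v w) (hgc : φ g = c) :
    w ∈ Set.range y := by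
  have hn := h.two_lt
  have hφ := h.almost.proper
  obtain ⟨j, hj, rfl⟩ := h.exists_lt hv
  have next : φ (f j) = c → w ∈ Set.range y := by
    intro hfc
    obtain rfl := hφ.edge_eq hg.inc_left (h.link j).inc_left (hgc.trans hfc.symm)
    exact ⟨j + 1, (h.link j).right_unique hg⟩
  have prev : ∀ l, y (l + 1) = y j → φ (f l) = c → w ∈ Set.range y := by
    intro l hl hfc
    have hl' := h.link l
    rw [hl] at hl'
    obtain rfl := hφ.edge_eq hg.inc_left hl'.inc_right (hgc.trans hfc.symm)
    exact ⟨l, hl'.symm.right_unique hg⟩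
  rcases Nat.eq_zero_or_pos j with rfl | hj1
  · rcases hc with rfl | rfl
    · exact absurd hgc (h.left.2 g hg.inc_left)
    · refine prev (n - 1) ?_ ?_
      · rw [Nat.sub_add_cancel (by omega), h.y_eq_iff, Nat.mod_self, Nat.zero_mod]
      · have hodd := h.odd
        rw [← Nat.sub_add_cancel (show 1 ≤ n by omega), Nat.odd_add_one,
          Nat.not_odd_iff_even] at hodd
        rw [h.color _ (by omega) (by omega)]
        simp only [altColor, if_pos hodd]
  · obtain ⟨l, rfl⟩ : ∃ l, j = l + 1 := ⟨j - 1, by omega⟩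
    have hcol := h.color (l + 1) hj1 hj
    rw [altColor_succ] at hcol
    rcases Nat.eq_zero_or_pos l with rfl | hl
    · rcases hc with rfl | rfl
      · exact next (by rw [hcol]; simp [altColor])
      · exact absurd hgc (h.right.2 g hg.inc_left)
    · have hcol' := h.color l hl (by omega)
      unfold altColor at hcol hcol'
      by_cases hpar : Even l
      · rw [if_pos hpar] at hcol hcol'
        rcases hc with rfl | rfl
        · exact next hcol
        · exact prev l rfl hcol'
      · rw [if_neg hpar] at hcol hcol'
        rcases hc with rfl | rfl
        · exact prev l rfl hcol'
        · exact next hcol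

/-- If `w` were off the cycle, `y 0, …, y j, w` would be a Kierstead path, so `w` would share no
missing color with these vertices, nor, by the broom version, with `y (j + 1)`. Then `y j` and its
neighbors `y (j - 1)`, `y (j + 1)`, `w` would form an elementary claw. -/
lemma mem_of_isMissing_zero [G.Loopless] (h : G.IsAltCycle k e φ n y f a b) (hG : G.IsLarge k)
    (hclaw : G.IsClawSparse k) (hc : G.IsMissing k φ (y 0) c) {j : ℕ} (hj1 : 1 ≤ j) (hj : j < n)
    {g : β} {w : α} (hg : G.IsLink g (y j) w) (hgc : φ g = c) : w ∈ Set.range y := by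
  by_contra hw
  have hn := h.two_lt
  have hyw : ∀ i, y i ≠ w := fun i hi => hw ⟨i, hi⟩
  set y' := Function.update y (j + 1) w with hy'
  set f' := Function.update f j g with hf'
  have hyi : ∀ i ≤ j, y' i = y i := fun i hi => Function.update_of_ne (by omega) _ _
  have hyj : y' (j + 1) = w := Function.update_self _ _ _
  have hfi : ∀ i < j, f' i = f i := fun i hi => Function.update_of_ne (by omega) _ _
  have hfj : f' j = g := Function.update_self _ _ _
  have hP : G.IsKiersteadPath k e φ y' f' (j + 1) := by
    refine ⟨fun i hi => ?_, ?_, fun i hi h1 => ?_, fun u hu v hv huv => ?_⟩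
    · rcases (Nat.lt_succ_iff.1 hi).lt_or_eq with hi' | rfl
      · rw [hfi i hi', hyi i (by omega), hyi (i + 1) hi']
        exact h.link i
      · rw [hfj, hyi i le_rfl, hyj]
        exact hg
    · rw [hfi 0 (by omega), h.first]
    · rcases (Nat.lt_succ_iff.1 hi).lt_or_eq with hi' | rfl
      · obtain ⟨m, hm, hmiss⟩ := (h.isKiersteadPath hj).color i hi' h1
        exact ⟨m, hm, by rwa [hfi i hi', hyi m (by omega)]⟩
      · exact ⟨0, h1, by rw [hfj, hgc, hyi 0 (by omega)]; exact hc⟩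
    · simp only [Set.mem_Iic] at hu hv
      rcases hu.lt_or_eq with hu | rfl <;> rcases hv.lt_or_eq with hv | rfl
      · rw [hyi u (by omega), hyi v (by omega)] at huv
        exact h.inj (show u < n by omega) (show v < n by omega) huv
      · rw [hyi u (by omega), hyj] at huv
        exact absurd huv (hyw u)
      · rw [hyi v (by omega), hyj] at huv
        exact absurd huv.symm (hyw v)
      · rfl
  have hdisj : ∀ i ≤ j, ∀ c, G.IsMissing k φ (y i) c → ¬ G.IsMissing k φ w c := by
    intro i hi c h1 h2
    rw [← hyi i hi] at h1
    rw [← hyj] at h2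
    exact hG.kierstead (j + 1) φ h.almost hP i (by omega) c h1 h2
  have hdisj' : ∀ c, G.IsMissing k φ (y (j + 1)) c → ¬ G.IsMissing k φ w c := by
    rcases lt_or_eq_of_le (Nat.succ_le_of_lt hj) with hj' | hj'
    · intro c h1 h2
      rw [← hyj] at h2
      exact hG.kierstead_broom h.almost (h.isKiersteadPath hj') hP hyi
        (by rw [hyj]; exact (hyw _).symm) h1 h2
    -- Here `j + 1 = n`, so `y (j + 1) = y 0` already lies on the path.
    · have := h.periodic_y 0
      rw [zero_add, ← hj'] at this
      rw [← Nat.succ_eq_add_one, this]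
      exact hdisj 0 (by omega)
  obtain ⟨l, rfl⟩ : ∃ l, j = l + 1 := ⟨j - 1, by omega⟩
  have hW : G.IsElementary k φ (insert w {y l, y (l + 1), y (l + 1 + 1), y 0}) := by
    refine IsElementary.insert ((h.isElementary hG).mono ?_) ?_
    · rintro v (rfl | rfl | rfl | rfl) <;> exact ⟨_, rfl⟩
    · rintro v (rfl | rfl | rfl | rfl)
      · exact hdisj _ (by omega)
      · exact hdisj _ (by omega)
      · exact hdisj'
      · exact hdisj _ (by omega)
  refine hG.no_elementary_claw hclaw h.almost hW (x := y (l + 1)) (u₁ := y l)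
    (u₂ := y (l + 1 + 1)) (u₃ := w) (z := y 0) (by simp) (by simp) (by simp) (by simp) (by simp)
    h.inc_zero (h.link l).adj.symm (h.link (l + 1)).adj hg.adj (h.link l).ne.symm
    (h.link (l + 1)).ne hg.ne ?_ (hyw _) (hyw _)
  rw [ne_eq, h.y_eq_iff]
  intro h'
  have := Nat.ModEq.add_left_cancel' l (show l + 0 ≡ l + 2 [MOD n] from h')
  rw [Nat.ModEq, Nat.mod_eq_of_lt (by omega), Nat.mod_eq_of_lt (by omega)] at this
  omega

/-- Edges whose color is missing somewhere on the cycle do not leave the cycle. -/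
theorem mem_of_isMissing [G.Loopless] (h : G.IsAltCycle k e φ n y f a b) (hG : G.IsLarge k)
    (hclaw : G.IsClawSparse k) {u v w : α} (hu : u ∈ Set.range y) (hc : G.IsMissing k φ u c)
    (hv : v ∈ Set.range y) {g : β} (hg : G.IsLink g v w) (hgc : φ g = c) : w ∈ Set.range y := by
  by_cases hab : c = a ∨ c = b
  · exact h.mem_of_color_left_or_right hab hv hg hgc
  push Not at hab
  obtain ⟨m, hm, rfl⟩ := h.exists_lt hu
  obtain ⟨j, hj, rfl⟩ := h.exists_lt hv
  obtain ⟨e', φ', a', b', h', -, hcol⟩ := h.rotate hG m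
  replace hcol := hcol c hab.1 hab.2 hc.1.ne
  have hjm : m ≠ j := by
    rintro rfl
    exact hc.2 g hg.inc_left hgc
  obtain ⟨i, hi1, hi, hij⟩ : ∃ i, 1 ≤ i ∧ i < n ∧ y (i + m) = y j := by
    rcases lt_or_gt_of_ne hjm with hlt | hlt
    · exact ⟨j - m, by omega, by omega, by rw [Nat.sub_add_cancel hlt.le]⟩
    · refine ⟨j + n - m, by omega, by omega, ?_⟩
      rw [Nat.sub_add_cancel (by omega), h.periodic_y]
  rw [← hij] at hg
  obtain ⟨l, hl⟩ := h'.mem_of_isMissing_zero hG hclaw (c := c)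
    ⟨hc.1, fun g' hg' => by
      rw [ne_eq, hcol]
      exact hc.2 g' (by simpa using hg')⟩ hi1 hi hg ((hcol g).2 hgc)
  exact ⟨l + m, hl⟩

/-- Every vertex of the cycle misses a color that is not used on the cycle. -/
lemma exists_isMissing_ne [G.Loopless] (h : G.IsAltCycle k e φ n y f a b) (hG : G.IsLarge k)
    {v : α} (hv : v ∈ Set.range y) : ∃ c, G.IsMissing k φ v c ∧ c ≠ a ∧ c ≠ b := by
  have hE := h.isElementary hG
  have hmem : ∀ i, y i ∈ Set.range y := fun i => ⟨i, rfl⟩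
  have hl := h.link 0
  have hl' := hl
  rw [h.first] at hl'
  have huniq : ∀ i, v ≠ y i → ∀ d, G.IsMissing k φ (y i) d → ∀ c, G.IsMissing k φ v c → c ≠ d := by
    rintro i hne d hd c hc rfl
    exact hE hv (hmem i) hne c hc hd
  -- The ends of `e` miss at least two colors; by elementarity the other vertices miss neither `a`
  -- nor `b`.
  by_cases h0 : v = y 0
  · subst h0
    obtain ⟨c, hc, hca⟩ := Finset.exists_mem_ne (hG.one_lt_card_missing h.almost hl'.inc_left) a
    rw [mem_missingColors] at hc
    exact ⟨c, hc, hca, huniq 1 hl.ne b h.right c hc⟩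
  by_cases h1 : v = y 1
  · subst h1
    obtain ⟨c, hc, hcb⟩ := Finset.exists_mem_ne (hG.one_lt_card_missing h.almost hl'.inc_right) b
    rw [mem_missingColors] at hc
    exact ⟨c, hc, huniq 0 hl.ne.symm a h.left c hc, hcb⟩
  · obtain ⟨i, rfl⟩ := hv
    obtain ⟨c, hc⟩ := hG.exists_isMissing h.almost (h.link i).left_mem
    exact ⟨c, hc, huniq 0 h0 a h.left c hc, huniq 1 h1 b h.right c hc⟩

/-- A chain from a vertex of the cycle passes through every edge leaving the cycle that has
the first color of the chain. -/
lemma mem_chain_of_leaving [G.Loopless] (h : G.IsAltCycle k e φ n y f a b) (hG : G.IsLarge k)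
    (hclaw : G.IsClawSparse k) {d : ℕ} (hck : c < k) (hca : c ≠ a) (hcb : c ≠ b) (hda : d ≠ a)
    (hdb : d ≠ b) {p : ℕ → α} {L : ℕ} (hp : G.IsKempeChain φ c d p L) (hp0 : p 0 ∈ Set.range y)
    (hd : G.IsMissing k φ (p 0) d) {g : β} {v w : α} (hv : v ∈ Set.range y) (hg : G.IsLink g v w)
    (hgc : φ g = c) (hw : w ∉ Set.range y) : v ∈ p '' Set.Iic L := by
  by_contra hvK
  -- Otherwise a swap on the chain makes `c` missing at `p 0`, while `g` keeps the color `c` and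
  -- still leaves the cycle.
  have hK := hp.closed h.almost.proper
  refine hw ((h.kempe hck hd.1 hca hcb hda hdb hK).mem_of_isMissing hG hclaw hp0
    (isMissing_kempe_right hck ⟨0, by simp, rfl⟩ hd) hv hg ?_)
  rw [kempe_of_notMem hK hg.inc_left hvK, hgc]

/-- For each color at most one edge of that color leaves the cycle. -/
theorem leaving_unique [G.Loopless] (h : G.IsAltCycle k e φ n y f a b) (hG : G.IsLarge k)
    (hclaw : G.IsClawSparse k) (hck : c < k) {g₁ g₂ : β} {v₁ v₂ w₁ w₂ : α}
    (hv₁ : v₁ ∈ Set.range y) (hv₂ : v₂ ∈ Set.range y) (hg₁ : G.IsLink g₁ v₁ w₁)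
    (hg₂ : G.IsLink g₂ v₂ w₂) (hc₁ : φ g₁ = c) (hc₂ : φ g₂ = c) (hw₁ : w₁ ∉ Set.range y)
    (hw₂ : w₂ ∉ Set.range y) : v₁ = v₂ := by
  classical
  have hmiss : ∀ u ∈ Set.range y, ¬ G.IsMissing k φ u c := fun u hu hc =>
    hw₁ (h.mem_of_isMissing hG hclaw hu hc hv₁ hg₁ hc₁)
  have hca : c ≠ a := by
    rintro rfl
    exact hmiss _ ⟨0, rfl⟩ h.left
  have hcb : c ≠ b := by
    rintro rfl
    exact hmiss _ ⟨1, rfl⟩ h.right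
  have h0 : y 0 ∈ Set.range y := ⟨0, rfl⟩
  obtain ⟨d, hd, hda, hdb⟩ := h.exists_isMissing_ne hG h0
  have hcd : c ≠ d := by
    rintro rfl
    exact hmiss _ h0 hd
  obtain ⟨p, L, hp0, hp⟩ := h.almost.proper.exists_isKempeChain hG.finite (h.link 0).left_mem c hd.2
  set P : ℕ → Prop := fun i => p i ∈ Set.range y with hP
  have hP0 : P 0 := by rw [hP]; simp only [hp0]; exact h0
  -- `p t` is the last vertex of the chain on the cycle. The chain goes on from there by an edge of
  -- color `c`, as those of color `d` do not leave.
  set t := Nat.findGreatest P L with ht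
  have htP : P t := Nat.findGreatest_spec (m := 0) (Nat.zero_le _) hP0
  have htL : t ≤ L := Nat.findGreatest_le L
  have hout : ∀ i, t < i → i ≤ L → p i ∉ Set.range y := fun i h1 h2 =>
    Nat.findGreatest_is_greatest h1 h2
  have hL : p L ∉ Set.range y := by
    intro hpL
    have hlast := hp.last
    rcases altColor_eq_or c d L with h' | h' <;> rw [h'] at hlast
    · exact hmiss _ hpL ⟨hck, hlast⟩
    · have hLp : p L = y 0 := by
        by_contra hne
        exact h.isElementary hG hpL h0 hne d ⟨hd.1, hlast⟩ hd
      have : L = 0 := hp.inj (show L ≤ L from le_rfl) (Nat.zero_le L) (hLp.trans hp0.symm)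
      rw [this, altColor_zero] at h'
      exact hcd h'
  have htL' : t < L := lt_of_le_of_ne htL fun h' => hL (h' ▸ htP)
  have hteven : Even t := by
    by_contra hodd
    obtain ⟨g, hg, hgc⟩ := hp.link t htL'
    rw [altColor, if_neg hodd] at hgc
    exact hout (t + 1) (by omega) htL' (h.mem_of_isMissing hG hclaw h0 hd htP hg hgc)
  obtain ⟨d', hd', hda', hdb'⟩ := h.exists_isMissing_ne hG htP
  have hcd' : c ≠ d' := by
    rintro rfl
    exact hmiss _ htP hd'
  have hK : G.IsKempeClosed φ d d' (Set.range y) := by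
    rintro g x z hg (hgd | hgd) hx
    · exact h.mem_of_isMissing hG hclaw h0 hd hx hg hgd
    · exact h.mem_of_isMissing hG hclaw htP hd' hx hg hgd
  have halt : ∀ i, altColor c d (i + t) = altColor c d i := by
    intro i
    unfold altColor
    simp only [Nat.even_add, hteven, iff_true]
  -- Exchanging `d` and `d'` at the cycle makes `d` missing at `p t`, so the rest of the old chain
  -- is a full chain from `p t`. It meets the cycle only there, yet contains the inner end of every
  -- leaving edge of color `c`.
  have hchain : G.IsKempeChain (G.kempe φ d d' (Set.range y)) c d (fun i => p (i + t)) (L - t) := by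
    refine ⟨fun i hi => ?_, ?_, ?_, fun u hu v hv huv => ?_⟩
    · obtain ⟨g, hg, hgc⟩ := hp.link (i + t) (by omega)
      rw [halt] at hgc
      refine ⟨g, by rwa [show i + 1 + t = i + t + 1 by ring], ?_⟩
      rw [kempe_of_notMem hK hg.inc_right (hout _ (by omega) (by omega)), hgc]
    · simp only [zero_add]
      exact (isMissing_kempe_right hd.1 htP hd').2
    · simp only [Nat.sub_add_cancel htL]
      intro g hg
      rw [kempe_of_notMem hK hg hL, ← halt, Nat.sub_add_cancel htL]
      exact hp.last g hg
    · simp only [Set.mem_Iic] at hu hv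
      have := hp.inj (show u + t ≤ L by omega) (show v + t ≤ L by omega) huv
      omega
  have key : ∀ {g v w}, v ∈ Set.range y → G.IsLink g v w → φ g = c → w ∉ Set.range y →
      v = p t := by
    intro g v w hv hg hgc hw
    obtain ⟨i, hi, hiv⟩ := (h.kempe hd.1 hd'.1 hda hdb hda' hdb' hK).mem_chain_of_leaving hG hclaw
      hck hca hcb hda hdb hchain (by simp only [zero_add]; exact htP)
      (by simpa using isMissing_kempe_right hd.1 htP hd') hv hg
      ((kempe_eq_iff hcd hcd').2 hgc) hw
    simp only [Set.mem_Iic] at hi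
    dsimp only at hiv
    rcases Nat.eq_zero_or_pos i with rfl | hi1
    · rw [← hiv, zero_add]
    · exact absurd (hiv ▸ hv) (hout (i + t) (by omega) (by omega))
  exact (key hv₁ hg₁ hc₁ hw₁).trans (key hv₂ hg₂ hc₂ hw₂).symm

end IsAltCycle

/-! ### Counting color classes inside the cycle -/

/-- The vertices of `C` covered by edges of color `c` satisfying `P`. -/
noncomputable def coveredBy (G : Graph α β) (φ : β → ℕ) (P : β → Prop) (C : Finset α) (c : ℕ) :
    Finset α :=
  open Classical in C.filter fun v => ∃ g, G.Inc g v ∧ P g ∧ φ g = c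

lemma mem_coveredBy {P : β → Prop} {C : Finset α} {c : ℕ} {v : α} :
    v ∈ G.coveredBy φ P C c ↔ v ∈ C ∧ ∃ g, G.Inc g v ∧ P g ∧ φ g = c := by
  simp [coveredBy]

/-- Double counting: the right side does not involve the coloring, so two colorings can be compared.
-/
lemma IsProper.sum_card_coveredBy (hφ : G.IsProper φ) {N : ℕ} (hN : ∀ g ∈ E(G), φ g < N)
    (P : β → Prop) (C : Finset α) :
    ∑ c ∈ Finset.range N, (G.coveredBy φ P C c).card =
      ∑ v ∈ C, {g | G.Inc g v ∧ P g}.ncard := by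
  classical
  rw [← Finset.sum_congr rfl fun v _ => hφ.card_present hN v P]
  have := Finset.sum_card_bipartiteAbove_eq_sum_card_bipartiteBelow (s := C) (t := Finset.range N)
    (fun v c => ∃ g, G.Inc g v ∧ P g ∧ φ g = c)
  unfold coveredBy
  unfold Finset.bipartiteAbove Finset.bipartiteBelow at this
  convert this.symm using 2

/-- The edges of one color inside `C` cover an even number of vertices. -/
lemma IsProper.even_card_coveredBy [G.Loopless] (hφ : G.IsProper φ) {P : β → Prop} {C : Finset α}
    (hP : ∀ g x, P g → G.Inc g x → x ∈ C) (c : ℕ) : Even (G.coveredBy φ P C c).card := by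
  have hmem : ∀ v ∈ G.coveredBy φ P C c, ∃ g, G.IsLink g v (G.partner φ c v) ∧ P g ∧ φ g = c := by
    intro v hv
    obtain ⟨-, g, ⟨w, hw⟩, hPg, rfl⟩ := mem_coveredBy.1 hv
    exact ⟨g, by rwa [hφ.partner_eq hw], hPg, rfl⟩
  have h : ∑ v ∈ G.coveredBy φ P C c, (1 : ZMod 2) = 0 := by
    refine Finset.sum_involution (fun v _ => G.partner φ c v) (fun _ _ => by decide)
      (fun v hv _ => ?_) (fun v hv => ?_) (fun v _ => hφ.partner_partner c)
    · obtain ⟨g, hg, -⟩ := hmem v hv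
      exact hg.ne.symm
    · obtain ⟨g, hg, hPg, hc⟩ := hmem v hv
      exact mem_coveredBy.2 ⟨hP g _ hPg hg.inc_right, g, hg.inc_right, hPg, hc⟩
  rw [Finset.sum_const, nsmul_one] at h
  exact (ZMod.natCast_eq_zero_iff_even).1 h

variable {n : ℕ} {y : ℕ → α} {f : ℕ → β} {a b : ℕ}

/-- If every `G - g` is `k`-edge-colorable, then all edges of `G` join vertices of the cycle. -/
theorem IsAltCycle.mem_of_inc [G.Loopless] (h : G.IsAltCycle k e φ n y f a b) (hG : G.IsLarge k)
    (hclaw : G.IsClawSparse k)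
    (hcrit : ∀ g ∈ E(G), ∃ ψ, (G.deleteEdges {g}).IsEdgeColoring k ψ) {g₀ : β} {x₀ : α}
    (hg₀ : G.Inc g₀ x₀) : x₀ ∈ Set.range y := by
  classical
  by_contra hx₀
  have hn := h.two_lt
  obtain ⟨C, hC, hCn⟩ : ∃ C : Finset α, (∀ v, v ∈ C ↔ v ∈ Set.range y) ∧ C.card = n := by
    refine ⟨(Finset.range n).image y, fun v => ?_, ?_⟩
    · simp only [Finset.mem_image, Finset.mem_range]
      exact ⟨fun ⟨i, _, hi⟩ => ⟨i, hi⟩, h.exists_lt⟩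
    · rw [Finset.card_image_of_injOn, Finset.card_range]
      intro i hi j hj
      exact h.inj (by simpa using hi) (by simpa using hj)
  set P : β → Prop := fun g => ∀ x, G.Inc g x → x ∈ C with hP
  have hPlink : ∀ {g v w}, G.IsLink g v w → v ∈ C → w ∈ C → P g := by
    intro g v w hg hv hw x hx
    rcases hx.eq_or_eq_of_isLink hg with rfl | rfl <;> assumption
  have hlower : ∀ c ∈ Finset.range k, n - 1 ≤ (G.coveredBy φ P C c).card := by
    intro c hc
    have hck := Finset.mem_range.1 hc
    -- An uncovered vertex misses `c` or sends an edge of color `c` out of `C`; two such vertices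
    -- cannot coexist.
    have hrest : (C \ G.coveredBy φ P C c).card ≤ 1 := by
      have hcase : ∀ v ∈ C \ G.coveredBy φ P C c, v ∈ Set.range y ∧ (G.IsMissing k φ v c ∨
          ∃ g w, G.IsLink g v w ∧ φ g = c ∧ w ∉ Set.range y) := by
        intro v hv
        rw [Finset.mem_sdiff, mem_coveredBy] at hv
        refine ⟨(hC v).1 hv.1, ?_⟩
        by_contra! hne
        obtain ⟨g, ⟨w, hw⟩, hgc⟩ : ∃ g, G.Inc g v ∧ φ g = c := by
          by_contra! hno
          exact hne.1 ⟨hck, hno⟩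
        exact hv.2 ⟨hv.1, g, hw.inc_left,
          hPlink hw hv.1 ((hC w).2 (hne.2 g w hw hgc)), hgc⟩
      refine Finset.card_le_one.2 fun u hu v hv => ?_
      obtain ⟨hu, hu' | ⟨g, w, hg, hgc, hw⟩⟩ := hcase u hu <;>
        obtain ⟨hv, hv' | ⟨g', w', hg', hgc', hw'⟩⟩ := hcase v hv
      · by_contra hne
        exact h.isElementary hG hu hv hne c hu' hv'
      · exact absurd (h.mem_of_isMissing hG hclaw hu hu' hv hg' hgc') hw'
      · exact absurd (h.mem_of_isMissing hG hclaw hv hv' hu hg hgc) hw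
      · exact h.leaving_unique hG hclaw hck hu hv hg hg' hgc hgc' hw hw'
    have hsub : G.coveredBy φ P C c ⊆ C := fun v hv => (mem_coveredBy.1 hv).1
    have := Finset.card_sdiff_add_card_eq_card hsub
    omega
  -- The ends of `e` push the total above `k * (n - 1)`.
  have hdummy : 2 ≤ (G.coveredBy φ P C k).card := by
    have hl := h.link 0
    have h0 : y 0 ∈ C := (hC _).2 ⟨0, rfl⟩
    have h1 : y 1 ∈ C := (hC _).2 ⟨1, rfl⟩
    have hk : φ (f 0) = k := (h.almost.eq_iff _ hl.edge_mem).2 h.first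
    rw [← Finset.card_pair hl.ne]
    refine Finset.card_le_card fun v hv => ?_
    simp only [Finset.mem_insert, Finset.mem_singleton] at hv
    rcases hv with rfl | rfl
    · exact mem_coveredBy.2 ⟨h0, f 0, hl.inc_left, hPlink hl h0 h1, hk⟩
    · exact mem_coveredBy.2 ⟨h1, f 0, hl.inc_right, hPlink hl h0 h1, hk⟩
  have hsum := h.almost.proper.sum_card_coveredBy
    (fun g hg => Nat.lt_succ_of_le (h.almost.le g hg)) P C
  rw [Finset.sum_range_succ] at hsum
  have hge := Finset.card_nsmul_le_sum _ _ _ hlower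
  obtain ⟨ψ, hψk, hψ⟩ := hcrit g₀ hg₀.edge_mem
  have : (G.deleteEdges {g₀}).Loopless := Loopless.anti deleteEdges_le
  have hPg₀ : ¬ P g₀ := fun hp => hx₀ ((hC _).1 (hp _ hg₀))
  have hψp : (G.deleteEdges {g₀}).IsProper ψ := hψ
  -- Parity: an even number of covered vertices among the odd number `n`. Deleting `g₀` does not
  -- affect the edges inside `C`, so the two totals conflict.
  have hupper : ∀ c ∈ Finset.range k, ((G.deleteEdges {g₀}).coveredBy ψ P C c).card ≤ n - 1 := by
    intro c _
    have heven := hψp.even_card_coveredBy (P := P) (C := C)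
      (fun g x hg hx => hg x (deleteEdges_inc.1 hx).1) c
    have hle : ((G.deleteEdges {g₀}).coveredBy ψ P C c).card ≤ n := by
      rw [← hCn]
      exact Finset.card_le_card fun v hv => (mem_coveredBy.1 hv).1
    have hodd := h.odd
    rw [← Nat.not_even_iff_odd] at hodd
    have : ((G.deleteEdges {g₀}).coveredBy ψ P C c).card ≠ n := fun h' => hodd (h' ▸ heven)
    omega
  have hle := Finset.sum_le_card_nsmul _ _ _ hupper
  rw [hψp.sum_card_coveredBy hψk] at hle
  have heq : ∀ v, {g | (G.deleteEdges {g₀}).Inc g v ∧ P g} = {g | G.Inc g v ∧ P g} := by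
    intro v
    ext g
    simp only [deleteEdges_inc, Set.mem_singleton_iff, Set.mem_ofPred_eq]
    constructor
    · exact fun hg => ⟨hg.1.1, hg.2⟩
    · exact fun hg => ⟨⟨hg.1, by rintro rfl; exact hPg₀ hg.2⟩, hg.2⟩
  simp only [heq] at hle
  omega

lemma IsAltCycle.isThickenedCycle [G.Loopless] (h : G.IsAltCycle k e φ n y f a b)
    (hG : G.IsLarge k) (hclaw : G.IsClawSparse k) (hV : V(G) ⊆ Set.range y) :
    G.IsThickenedCycle := by
  have hn := h.two_lt
  have hmem : ∀ i, y i ∈ V(G) := fun i => (h.link i).left_mem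
  have hbij : Function.Bijective fun i : Fin n => (⟨y i, hmem i⟩ : V(G)) := by
    constructor
    · intro i j hij
      exact Fin.ext (h.inj i.2 j.2 (Subtype.ext_iff.1 hij))
    · rintro ⟨v, hv⟩
      obtain ⟨i, hi, rfl⟩ := h.exists_lt (hV hv)
      exact ⟨⟨i, hi⟩, rfl⟩
  have hsub : ∀ i j : Fin n, (i - j).val = 1 ↔ (i : ℕ) % n = (j + 1) % n := by
    rintro ⟨i, hi⟩ ⟨j, hj⟩
    rw [Fin.val_sub]
    simp only
    rw [Nat.mod_eq_of_lt hi]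
    have h1 : (n - j + i) % n = if j ≤ i then i - j else n - j + i := by
      split_ifs with hji
      · rw [show n - j + i = i - j + n by omega, Nat.add_mod_right, Nat.mod_eq_of_lt (by omega)]
      · exact Nat.mod_eq_of_lt (by omega)
    have h2 : (j + 1) % n = if j + 1 = n then 0 else j + 1 := by
      split_ifs with hjn
      · rw [hjn, Nat.mod_self]
      · exact Nat.mod_eq_of_lt (by omega)
    rw [h1, h2]
    split_ifs <;> omega
  refine ⟨n, hn, ⟨RelIso.symm ⟨Equiv.ofBijective _ hbij, ?_⟩⟩⟩
  intro i j
  rw [toSimpleGraph_adj_iff, SimpleGraph.cycleGraph_adj', hsub, hsub, or_comm]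
  exact h.adj_iff hG hclaw

/-! ### From critical graphs to the theorem -/

lemma exists_isAlmostColoring (he : e ∈ E(G))
    (hcol : ∃ ψ, (G.deleteEdges {e}).IsEdgeColoring k ψ) :
    ∃ φ, G.IsAlmostColoring k e φ := by
  classical
  obtain ⟨ψ, hψk, hψ⟩ := hcol
  have hlt : ∀ g ∈ E(G), g ≠ e → ψ g < k := fun g hg hne => hψk g (by simp [hg, hne])
  refine ⟨fun g => if g = e then k else ψ g, fun g h x hne hg hh => ?_, he, fun g hg => ?_,
    fun g hg => ?_⟩
  · split_ifs with h1 h2 h2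
    · exact absurd (h1.trans h2.symm) hne
    · exact (hlt h hh.edge_mem h2).ne'
    · exact (hlt g hg.edge_mem h1).ne
    · exact hψ g h x hne (deleteEdges_inc.2 ⟨hg, h1⟩) (deleteEdges_inc.2 ⟨hh, h2⟩)
  · split_ifs with h1
    · exact le_rfl
    · exact (hlt g hg h1).le
  · split_ifs with h1
    · simp [h1]
    · simp [h1, (hlt g hg h1).ne]

lemma degree_le_maxDegree (hV : V(G).Finite) {v : α} (hv : v ∈ V(G)) :
    G.degree v ≤ G.maxDegree := by
  have := hV.to_subtype
  exact le_ciSup (f := fun v : V(G) => G.degree v) (Set.finite_range _).bddAbove ⟨v, hv⟩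

lemma le_clawDegree (hV : V(G).Finite) {x : α} {S : Finset α} (hS : (S : Set α) ⊆ G.neighbors x)
    (hcard : S.card = 3) :
    (1 / 4 : ℝ) * ((G.degree x : ℝ) + ∑ v ∈ S, (G.degree v : ℝ)) ≤ G.clawDegree := by
  have hx : x ∈ V(G) := by
    obtain ⟨v, hv⟩ := Finset.card_pos.1 (by omega : 0 < S.card)
    exact Adj.left_mem (hS hv)
  have := hV.to_subtype
  refine le_trans ?_ (le_ciSup (f := fun x : V(G) => G.clawDegreeAt x)
    (Set.finite_range _).bddAbove ⟨x, hx⟩)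
  refine le_csSup ⟨G.maxDegree, ?_⟩ ⟨S, hS, hcard, rfl⟩
  rintro r ⟨T, hT, hTcard, rfl⟩
  have h1 : (G.degree x : ℝ) ≤ G.maxDegree := by exact_mod_cast degree_le_maxDegree hV hx
  have h2 : ∑ v ∈ T, (G.degree v : ℝ) ≤ T.card • (G.maxDegree : ℝ) :=
    Finset.sum_le_card_nsmul _ _ _ fun v hv => by
      exact_mod_cast degree_le_maxDegree hV (Adj.right_mem (hT hv))
  rw [hTcard, nsmul_eq_mul] at h2
  push_cast at h2
  linarith

lemma isClawSparse_of_clawDegree_le (hV : V(G).Finite) (h : (4 / 3 : ℝ) * G.clawDegree ≤ k) :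
    G.IsClawSparse k := by
  intro x S hS hcard
  have := le_clawDegree hV hS hcard
  have h' : (G.degree x : ℝ) + ∑ v ∈ S, (G.degree v : ℝ) ≤ 3 * k := by linarith
  exact_mod_cast h'

/-- A critical graph without isolated vertices that is not `k`-edge-colorable, where `k` exceeds
the maximum degree and every claw has degree sum at most `3 * k`, is a thickened cycle. -/
theorem IsLarge.isThickenedCycle [G.Loopless] (hG : G.IsLarge k) (hclaw : G.IsClawSparse k)
    (hcrit : ∀ g ∈ E(G), ∃ ψ, (G.deleteEdges {g}).IsEdgeColoring k ψ)
    (hisolated : ∀ v ∈ V(G), G.degree v ≠ 0) : G.IsThickenedCycle := by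
  obtain ⟨e, he⟩ : ∃ e, e ∈ E(G) := by
    by_contra! hno
    exact hG.not_colorable ⟨0, fun e he => absurd he (hno e),
      fun g _ _ _ hg _ => absurd hg.edge_mem (hno g)⟩
  obtain ⟨φ, hφ⟩ := exists_isAlmostColoring he (hcrit e he)
  obtain ⟨n, y, f, a, b, h⟩ := hG.exists_isAltCycle hφ
  refine h.isThickenedCycle hG hclaw fun v hv => ?_
  obtain ⟨g, hg⟩ := Set.nonempty_of_ncard_ne_zero (hisolated v hv)
  exact h.mem_of_inc hG hclaw hcrit hg

end Graph

theorem mainTheorem6 {α β : Type*} (G : Graph α β) [G.Loopless]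
    (hV : V(G).Finite) (hE : E(G).Finite)
    (hisolated : ∀ v ∈ V(G), G.degree v ≠ 0)
    (hcritical : G.IsCritical) (hcycle : ¬ G.IsThickenedCycle) :
    G.chromaticIndex ≤ max (G.maxDegree + 1) ⌈(4 / 3 : ℝ) * G.clawDegree⌉₊ := by
  by_contra! hlt
  rw [max_lt_iff] at hlt
  obtain ⟨k, hk⟩ : ∃ k, G.chromaticIndex = k + 1 := ⟨G.chromaticIndex - 1, by omega⟩
  rw [hk] at hlt
  have hG : G.IsLarge k := by
    refine ⟨hV, fun hc => ?_, fun v hv => ?_⟩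
    · have : G.chromaticIndex ≤ k := Nat.sInf_le hc
      omega
    · have := Graph.degree_le_maxDegree hV hv
      omega
  have hclaw : G.IsClawSparse k := Graph.isClawSparse_of_clawDegree_le hV
    ((Nat.le_ceil _).trans (by exact_mod_cast Nat.lt_succ_iff.1 hlt.2))
  refine hcycle (hG.isThickenedCycle hclaw (fun g hg => ?_) hisolated)
  have hlt' := hcritical g hg
  -- Since `sInf ∅ = 0`, a positive chromatic index guarantees a coloring; its restriction shows
  -- that the infimum for `G - g` is attained.
  obtain ⟨N, c, hcN, hc⟩ : {N | ∃ c, G.IsEdgeColoring N c}.Nonempty :=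
    Nat.nonempty_of_pos_sInf (by rw [← Graph.chromaticIndex, hk]; omega)
  have hne : {N | ∃ c, (G.deleteEdges {g}).IsEdgeColoring N c}.Nonempty :=
    ⟨N, c, fun e he => hcN e he.1, fun e f x hef he hf =>
      hc e f x hef (Graph.deleteEdges_inc.1 he).1 (Graph.deleteEdges_inc.1 hf).1⟩
  obtain ⟨ψ, hψ, hψ'⟩ := Nat.sInf_mem hne
  refine ⟨ψ, fun e he => (hψ e he).trans_le ?_, hψ'⟩
  rw [← Graph.chromaticIndex]
  omega
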